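/- Let $\mathbb H_{\mathbb C}$ be the algebra of complex $2\times2$ matrices $Z=\left(\begin{smallmatrix}z_{11}&z_{12}\\z_{21}&z_{22}\end{smallmatrix}\right)$, $N(Z)=\det Z$, $Z^+=\left(\begin{smallmatrix}z_{22}&-z_{12}\\-z_{21}&z_{11}\end{smallmatrix}\right)$, and let $\mathbb H_{\mathbb C}^\times$ be its group of invertible elements. Let $\mathcal W'$ be the complex vector space of functions $F:\mathbb H_{\mathbb C}^\times\to\mathbb H_{\mathbb C}$ whose four entries lie in $\mathbb C[z_{11},z_{12},z_{21},z_{22},N(Z)^{-1}]$. Put $\partial_{ij}=\partial/\partial z_{ij}$, $\partial=\left(\begin{smallmatrix}\partial_{11}&\partial_{21}\\\partial_{12}&\partial_{22}\end{smallmatrix}\right)$, $\nabla=2\partial$, $\square=4(\partial_{11}\partial_{22}-\partial_{12}\partial_{21})$, and for $F\in\mathcal W'$ let $\operatorname{Mx}F=\nabla F\nabla-\square F^+$, where $\nabla F\nabla$ means that $\nabla$ is applied to $F$ by matrix multiplication on the left and on the right. $F$ is called harmonic if $\square F=0$, biharmonic if $\square\square F=0$, and homogeneous of degree $d$ if $F(cZ)=c^dF(Z)$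 for all $c\in\mathbb C^\times$. The Lie algebra $\mathfrak{gl}(2,\mathbb H_{\mathbb C})$ of $2\times2$ matrices over $\mathbb H_{\mathbb C}$ acts on $\mathcal W'$ by $\rho_2'$, the derivative of $$(\rho_2'(h)F)(Z)=\frac{a'-Zc'}{N(a'-Zc')}\cdot F\bigl((aZ+b)(cZ+d)^{-1}\bigr)\cdot\frac{cZ+d}{N(cZ+d)},\qquad h=\left(\begin{smallmatrix}a'&b'\\c'&d'\end{smallmatrix}\right),\quad h^{-1}=\left(\begin{smallmatrix}a&b\\c&d\end{smallmatrix}\right)\in GL(2,\mathbb H_{\mathbb C}).$$ Let $\ker\operatorname{Mx}=\{F\in\mathcal W':\operatorname{Mx}F=0\}$ and $$\mathcal M=\{F\in\mathcal W':\ \operatorname{Mx}F=0,\ \operatorname{Tr}(\partial\circ\square F)=0\}.$$ 1. The sum of $\mathcal M$ and the line $\mathbb C\cdot N(Z)Z$ is direct, and $$\mathcal M\oplus\mathbb C\cdot N(Z)Z=\{F\in\mathcal W':\ \operatorname{Mx}F=0,\ \square\square F=0\}.$$ 2. $\mathcal M$ is the linear span of $N(Z)^{-1}Z$ and of all the elements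 $$A_d(Z)+\frac{N(Z)}{d+1}\bigl(\partial A_d(Z)\partial\bigr)^+,$$ where $d\ne-1$ is an integer and $A_d\in\mathcal W'$ is harmonic and homogeneous of degree $d$; each of these elements is homogeneous of degree $d$. 3. $\mathcal M$ is the unique maximal $\rho_2'$-invariant subspace of $\ker\operatorname{Mx}$ consisting of biharmonic functions; more precisely, it is such a subspace and it contains every other one. -/

import Mathlib

noncomputable section

namespace QuatAnalysis

/-- The complexified quaternions `ℍ_ℂ = ℍ ⊗ ℂ`, realized as the complex `2 × 2` matrices
`Z = (z₁₁ z₁₂; z₂₁ z₂₂)` (the indices `1, 2` are `0, 1 : Fin 2`).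
The set `ℍ_ℂ^×` of invertible elements is the group of units `HCˣ`. -/
abbrev HC : Type := Matrix (Fin 2) (Fin 2) ℂ

/-- The quadratic form `N(Z) = z₁₁ z₂₂ - z₁₂ z₂₁`. -/
def N (Z : HC) : ℂ := Z.det

/-- The quaternionic conjugate `Z⁺ = (z₂₂ -z₁₂; -z₂₁ z₁₁)`. -/
def qconj (Z : HC) : HC := Z.adjugate

/-- The partial derivative `∂_{ij} f = ∂f / ∂z_{ij}` of a function on the open set
`ℍ_ℂ^×` (the value given to `f` outside of `ℍ_ℂ^×` plays no role). -/
def pd (i j : Fin 2) (f : HCˣ → ℂ) : HCˣ → ℂ := fun Z =>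
  deriv (fun t : ℂ => Function.extend Units.val f 0 ((Z : HC) + t • Matrix.single i j 1)) 0

/-- The algebra `ℂ[z₁₁, z₁₂, z₂₁, z₂₂, N(Z)⁻¹]` of complex-valued polynomial functions
on `ℍ_ℂ^×`. -/
def Sh : Subalgebra ℂ (HCˣ → ℂ) :=
  Algebra.adjoin ℂ
    (Set.range (fun (p : Fin 2 × Fin 2) (Z : HCˣ) => (Z : HC) p.1 p.2) ∪
      {fun Z : HCˣ => (N (Z : HC))⁻¹})

/-- The space `𝒲'` of `ℍ_ℂ`-valued polynomial functions on `ℍ_ℂ^×`. -/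
def W' : Submodule ℂ (HCˣ → HC) where
  carrier := {F | ∀ i j, (fun Z => F Z i j) ∈ Sh}
  add_mem' hF hG i j := Sh.add_mem (hF i j) (hG i j)
  zero_mem' _ _ := Sh.zero_mem
  smul_mem' c _ hF i j := Sh.smul_mem (hF i j) c

/-- `∂F`: the matrix `∂ = (∂₁₁ ∂₂₁; ∂₁₂ ∂₂₂)` applied to `F` on the left. -/
def delL (F : HCˣ → HC) : HCˣ → HC := fun Z =>
  Matrix.of fun a b => ∑ k, pd k a (fun Y => F Y k b) Z

/-- `F∂`: the matrix `∂ = (∂₁₁ ∂₂₁; ∂₁₂ ∂₂₂)` applied to `F` on the right. -/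
def delR (F : HCˣ → HC) : HCˣ → HC := fun Z =>
  Matrix.of fun a b => ∑ k, pd b k (fun Y => F Y a k) Z

/-- `∇F`, where `∇ = 2∂`. -/
def nablaL (F : HCˣ → HC) : HCˣ → HC := (2 : ℂ) • delL F

/-- `F∇`, where `∇ = 2∂`. -/
def nablaR (F : HCˣ → HC) : HCˣ → HC := (2 : ℂ) • delR F

/-- The Laplacian `□ = 4(∂₁₁∂₂₂ - ∂₁₂∂₂₁)` on complex-valued functions. -/
def box (f : HCˣ → ℂ) : HCˣ → ℂ :=
  (4 : ℂ) • (pd 0 0 (pd 1 1 f) - pd 0 1 (pd 1 0 f))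

/-- The Laplacian `□` on `ℍ_ℂ`-valued functions, entry by entry. -/
def boxM (F : HCˣ → HC) : HCˣ → HC := fun Z =>
  Matrix.of fun a b => box (fun Y => F Y a b) Z

/-- The operator `Mx F = ∇F∇ - □F⁺`. -/
def Mx (F : HCˣ → HC) : HCˣ → HC :=
  nablaR (nablaL F) - boxM (fun Z => qconj (F Z))

/-- The operator `F ↦ Tr(∂ ∘ □ F)`. -/
def trDelBox (F : HCˣ → HC) : HCˣ → ℂ := fun Z => (delL (boxM F) Z).trace

/-! ### Polynomial functions are differentiable, and the operators are linear on them -/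

theorem extend_unit {E : Type*} [Zero E] (f : HCˣ → E) (Z : HCˣ) :
    Function.extend Units.val f 0 (Z : HC) = f Z :=
  Units.val_injective.extend_apply f 0 Z

theorem eventually_isUnit (Z : HCˣ) (E : HC) :
    ∀ᶠ t : ℂ in nhds 0, IsUnit ((Z : HC) + t • E) := by
  have hc : Continuous fun t : ℂ => ((Z : HC) + t • E).det := by
    apply Continuous.matrix_det
    fun_prop
  have h0 : ((Z : HC) + (0 : ℂ) • E).det ≠ 0 := by
    simpa using (Matrix.isUnit_iff_isUnit_det _).1 Z.isUnit
  filter_upwards [hc.continuousAt.eventually_ne h0] with t ht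
  exact (Matrix.isUnit_iff_isUnit_det _).2 (isUnit_iff_ne_zero.2 ht)

theorem extend_eventuallyEq (f : HCˣ → ℂ) (g : HC → ℂ) (h : ∀ Z : HCˣ, f Z = g Z)
    (Z : HCˣ) (E : HC) :
    (fun t : ℂ => Function.extend Units.val f 0 ((Z : HC) + t • E)) =ᶠ[nhds 0]
      fun t => g ((Z : HC) + t • E) := by
  filter_upwards [eventually_isUnit Z E] with t ht
  obtain ⟨u, hu⟩ := ht
  rw [← hu, extend_unit, h]

/-- Near `Z`, the extension by zero is compatible with an algebraic operation. -/
theorem extend_eventuallyEq₂ (op : ℂ → ℂ → ℂ) (f g : HCˣ → ℂ) (Z : HCˣ) (E : HC) :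
    (fun t : ℂ => Function.extend Units.val (fun Y => op (f Y) (g Y)) 0 ((Z : HC) + t • E))
      =ᶠ[nhds 0] fun t => op (Function.extend Units.val f 0 ((Z : HC) + t • E))
        (Function.extend Units.val g 0 ((Z : HC) + t • E)) := by
  filter_upwards [eventually_isUnit Z E] with t ht
  obtain ⟨u, hu⟩ := ht
  rw [← hu, extend_unit, extend_unit, extend_unit]

/-- The partial derivatives of `f` exist at every point of `ℍ_ℂ^×`. -/
def HasPd (f : HCˣ → ℂ) : Prop := ∀ (i j : Fin 2) (Z : HCˣ),
  DifferentiableAt ℂ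
    (fun t : ℂ => Function.extend Units.val f 0 ((Z : HC) + t • Matrix.single i j 1)) 0

theorem HasPd.add {f g : HCˣ → ℂ} (hf : HasPd f) (hg : HasPd g) : HasPd (f + g) :=
  fun i j Z => ((hf i j Z).add (hg i j Z)).congr_of_eventuallyEq
    (extend_eventuallyEq₂ (· + ·) f g Z _)

theorem HasPd.mul {f g : HCˣ → ℂ} (hf : HasPd f) (hg : HasPd g) : HasPd (f * g) :=
  fun i j Z => ((hf i j Z).mul (hg i j Z)).congr_of_eventuallyEq
    (extend_eventuallyEq₂ (· * ·) f g Z _)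

theorem pd_add {f g : HCˣ → ℂ} (hf : HasPd f) (hg : HasPd g) (i j : Fin 2) :
    pd i j (f + g) = pd i j f + pd i j g := by
  funext Z
  exact (extend_eventuallyEq₂ (· + ·) f g Z _).deriv_eq.trans
    (deriv_fun_add (hf i j Z) (hg i j Z))

theorem pd_mul {f g : HCˣ → ℂ} (hf : HasPd f) (hg : HasPd g) (i j : Fin 2) :
    pd i j (f * g) = pd i j f * g + f * pd i j g := by
  funext Z
  refine (extend_eventuallyEq₂ (· * ·) f g Z _).deriv_eq.trans
    ((deriv_fun_mul (hf i j Z) (hg i j Z)).trans ?_)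
  simp [pd, extend_unit]

theorem pd_smul (c : ℂ) (f : HCˣ → ℂ) (i j : Fin 2) : pd i j (c • f) = c • pd i j f := by
  funext Z
  exact (extend_eventuallyEq₂ (fun x _ => c * x) f f Z _).deriv_eq.trans
    (deriv_const_mul_field c)

theorem hasDerivAt_entry (Z : HCˣ) (i j k l : Fin 2) :
    HasDerivAt (fun t : ℂ => ((Z : HC) + t • (Matrix.single i j 1 : HC)) k l)
      ((Matrix.single i j 1 : HC) k l) 0 := by
  have h := ((hasDerivAt_id (0 : ℂ)).mul_const ((Matrix.single i j 1 : HC) k l)).const_add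
    ((Z : HC) k l)
  rw [one_mul] at h
  exact h

theorem hasDerivAt_N (Z : HCˣ) (i j : Fin 2) :
    HasDerivAt (fun t : ℂ => N ((Z : HC) + t • (Matrix.single i j 1 : HC)))
      ((Matrix.single i j 1 : HC) 0 0 * (Z : HC) 1 1 + (Z : HC) 0 0 * (Matrix.single i j 1 : HC) 1 1
        - ((Matrix.single i j 1 : HC) 0 1 * (Z : HC) 1 0
          + (Z : HC) 0 1 * (Matrix.single i j 1 : HC) 1 0)) 0 := by
  have h := ((hasDerivAt_entry Z i j 0 0).mul (hasDerivAt_entry Z i j 1 1)).sub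
    ((hasDerivAt_entry Z i j 0 1).mul (hasDerivAt_entry Z i j 1 0))
  simp only [zero_smul, add_zero] at h
  refine h.congr_of_eventuallyEq (Filter.Eventually.of_forall fun t => ?_)
  exact Matrix.det_fin_two _

theorem N_unit_ne_zero (Z : HCˣ) : N (Z : HC) ≠ 0 :=
  isUnit_iff_ne_zero.1 ((Matrix.isUnit_iff_isUnit_det _).1 Z.isUnit)

theorem coord_mem_Sh (k l : Fin 2) : (fun Z : HCˣ => (Z : HC) k l) ∈ Sh :=
  Algebra.subset_adjoin (Or.inl ⟨(k, l), rfl⟩)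

theorem invN_mem_Sh : (fun Z : HCˣ => (N (Z : HC))⁻¹) ∈ Sh :=
  Algebra.subset_adjoin (Or.inr rfl)

theorem const_mem_Sh (c : ℂ) : (fun _ : HCˣ => c) ∈ Sh :=
  Sh.algebraMap_mem c

/-- A polynomial function is differentiable and its partial derivatives are polynomial. -/
theorem Sh_aux {f : HCˣ → ℂ} (hf : f ∈ Sh) : HasPd f ∧ ∀ i j, pd i j f ∈ Sh := by
  induction hf using Algebra.adjoin_induction with
  | mem f hf =>
    rcases hf with ⟨⟨k, l⟩, rfl⟩ | hf
    · have key : ∀ (i j : Fin 2) (Z : HCˣ), HasDerivAt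
          (fun t : ℂ => Function.extend Units.val (fun Z : HCˣ => (Z : HC) k l) 0
            ((Z : HC) + t • Matrix.single i j 1)) ((Matrix.single i j 1 : HC) k l) 0 :=
        fun i j Z => (hasDerivAt_entry Z i j k l).congr_of_eventuallyEq
          (extend_eventuallyEq _ (fun Z : HC => Z k l) (fun _ => rfl) Z _)
      refine ⟨fun i j Z => (key i j Z).differentiableAt, fun i j => ?_⟩
      have : pd i j (fun Z : HCˣ => (Z : HC) k l) = fun _ => (Matrix.single i j 1 : HC) k l :=
        funext fun Z => (key i j Z).deriv
      exact this ▸ const_mem_Sh _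
    · rw [Set.mem_singleton_iff] at hf
      subst hf
      have key := fun (i j : Fin 2) (Z : HCˣ) =>
        ((hasDerivAt_N Z i j).inv (by simpa using N_unit_ne_zero Z)).congr_of_eventuallyEq
          (extend_eventuallyEq (fun Z : HCˣ => (N (Z : HC))⁻¹) (fun Z => (N Z)⁻¹)
            (fun _ => rfl) Z (Matrix.single i j 1))
      refine ⟨fun i j Z => (key i j Z).differentiableAt, fun i j => ?_⟩
      have h := funext fun Z => (key i j Z).deriv
      simp only [zero_smul, add_zero] at h
      have h2 : pd i j (fun Z : HCˣ => (N (Z : HC))⁻¹) = _ := h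
      rw [h2]
      have e : ∀ Z : HCˣ, ∀ x : ℂ, -x / N (Z : HC) ^ 2
          = (-1 : ℂ) * x * ((N (Z : HC))⁻¹ * (N (Z : HC))⁻¹) := fun Z x => by
        rw [div_eq_mul_inv, pow_two, mul_inv]; ring
      simp only [e]
      exact Sh.mul_mem (Sh.mul_mem (const_mem_Sh _) (Sh.sub_mem
        (Sh.add_mem (Sh.mul_mem (const_mem_Sh _) (coord_mem_Sh 1 1))
          (Sh.mul_mem (coord_mem_Sh 0 0) (const_mem_Sh _)))
        (Sh.add_mem (Sh.mul_mem (const_mem_Sh _) (coord_mem_Sh 1 0))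
          (Sh.mul_mem (coord_mem_Sh 0 1) (const_mem_Sh _)))))
        (Sh.mul_mem invN_mem_Sh invN_mem_Sh)
  | algebraMap c =>
    have key : ∀ (i j : Fin 2) (Z : HCˣ), HasDerivAt
        (fun t : ℂ => Function.extend Units.val (algebraMap ℂ (HCˣ → ℂ) c) 0
          ((Z : HC) + t • Matrix.single i j 1)) 0 0 :=
      fun i j Z => (hasDerivAt_const (0 : ℂ) c).congr_of_eventuallyEq
        (extend_eventuallyEq _ (fun _ => c) (fun _ => rfl) Z _)
    refine ⟨fun i j Z => (key i j Z).differentiableAt, fun i j => ?_⟩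
    have : pd i j (algebraMap ℂ (HCˣ → ℂ) c) = 0 := funext fun Z => (key i j Z).deriv
    exact this ▸ Sh.zero_mem
  | add f g _ _ hf hg =>
    exact ⟨hf.1.add hg.1, fun i j => by
      rw [pd_add hf.1 hg.1]; exact Sh.add_mem (hf.2 i j) (hg.2 i j)⟩
  | mul f g hfm hgm hf hg =>
    exact ⟨hf.1.mul hg.1, fun i j => by
      rw [pd_mul hf.1 hg.1]
      exact Sh.add_mem (Sh.mul_mem (hf.2 i j) hgm) (Sh.mul_mem hfm (hg.2 i j))⟩

theorem hasPd_of_mem {f : HCˣ → ℂ} (hf : f ∈ Sh) : HasPd f := (Sh_aux hf).1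

theorem pd_mem {f : HCˣ → ℂ} (hf : f ∈ Sh) (i j : Fin 2) : pd i j f ∈ Sh := (Sh_aux hf).2 i j

theorem pd_add_of_mem {f g : HCˣ → ℂ} (hf : f ∈ Sh) (hg : g ∈ Sh) (i j : Fin 2) :
    pd i j (f + g) = pd i j f + pd i j g := pd_add (hasPd_of_mem hf) (hasPd_of_mem hg) i j

theorem box_mem {f : HCˣ → ℂ} (hf : f ∈ Sh) : box f ∈ Sh :=
  Sh.smul_mem (Sh.sub_mem (pd_mem (pd_mem hf 1 1) 0 0) (pd_mem (pd_mem hf 1 0) 0 1)) _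

theorem box_add {f g : HCˣ → ℂ} (hf : f ∈ Sh) (hg : g ∈ Sh) : box (f + g) = box f + box g := by
  simp only [box, pd_add_of_mem hf hg, pd_add_of_mem (pd_mem hf _ _) (pd_mem hg _ _)]
  module

theorem box_smul (c : ℂ) (f : HCˣ → ℂ) : box (c • f) = c • box f := by
  simp only [box, pd_smul]
  module

theorem delL_mem {F : HCˣ → HC} (hF : F ∈ W') : delL F ∈ W' := fun a b => by
  have : (fun Z => delL F Z a b) = ∑ k, pd k a (fun Y => F Y k b) := by
    funext Z; simp [delL]
  rw [this]
  exact Sh.sum_mem fun k _ => pd_mem (hF k b) k a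

theorem boxM_mem {F : HCˣ → HC} (hF : F ∈ W') : boxM F ∈ W' := fun a b => box_mem (hF a b)

theorem qconj_mem {F : HCˣ → HC} (hF : F ∈ W') : (fun Z => qconj (F Z)) ∈ W' := by
  intro a b
  have hneg : ∀ i j, (fun Z => -F Z i j) ∈ Sh := fun i j => Sh.neg_mem (hF i j)
  fin_cases a <;> fin_cases b <;> simp [qconj, Matrix.adjugate_fin_two, hF _ _, hneg _ _]

theorem delL_add {F G : HCˣ → HC} (hF : F ∈ W') (hG : G ∈ W') :
    delL (F + G) = delL F + delL G := by
  funext Z; ext a b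
  have h : ∀ k, pd k a (fun Y => F Y k b + G Y k b) = _ := fun k =>
    pd_add_of_mem (hF k b) (hG k b) k a
  simp only [delL, Matrix.of_apply, Pi.add_apply, Matrix.add_apply, h, Finset.sum_add_distrib]

theorem delL_smul (c : ℂ) (F : HCˣ → HC) : delL (c • F) = c • delL F := by
  funext Z; ext a b
  have h : ∀ k, pd k a (fun Y => c • F Y k b) = _ := fun k =>
    pd_smul c (fun Y => F Y k b) k a
  simp only [delL, Matrix.of_apply, Pi.smul_apply, Matrix.smul_apply, h, Finset.smul_sum]

theorem delR_add {F G : HCˣ → HC} (hF : F ∈ W') (hG : G ∈ W') :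
    delR (F + G) = delR F + delR G := by
  funext Z; ext a b
  have h : ∀ k, pd b k (fun Y => F Y a k + G Y a k) = _ := fun k =>
    pd_add_of_mem (hF a k) (hG a k) b k
  simp only [delR, Matrix.of_apply, Pi.add_apply, Matrix.add_apply, h, Finset.sum_add_distrib]

theorem delR_smul (c : ℂ) (F : HCˣ → HC) : delR (c • F) = c • delR F := by
  funext Z; ext a b
  have h : ∀ k, pd b k (fun Y => c • F Y a k) = _ := fun k =>
    pd_smul c (fun Y => F Y a k) b k
  simp only [delR, Matrix.of_apply, Pi.smul_apply, Matrix.smul_apply, h, Finset.smul_sum]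

theorem boxM_add {F G : HCˣ → HC} (hF : F ∈ W') (hG : G ∈ W') :
    boxM (F + G) = boxM F + boxM G := by
  funext Z; ext a b
  exact congrFun (box_add (hF a b) (hG a b)) Z

theorem boxM_smul (c : ℂ) (F : HCˣ → HC) : boxM (c • F) = c • boxM F := by
  funext Z; ext a b
  exact congrFun (box_smul c fun Y => F Y a b) Z

theorem qconj_add (X Y : HC) : qconj (X + Y) = qconj X + qconj Y := by
  simp [qconj, Matrix.adjugate_fin_two, add_comm]

theorem qconj_smul (c : ℂ) (X : HC) : qconj (c • X) = c • qconj X := by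
  simp [qconj, Matrix.adjugate_fin_two]

theorem Mx_add {F G : HCˣ → HC} (hF : F ∈ W') (hG : G ∈ W') : Mx (F + G) = Mx F + Mx G := by
  have h : (fun Z => qconj ((F + G) Z)) = (fun Z => qconj (F Z)) + fun Z => qconj (G Z) :=
    funext fun Z => qconj_add _ _
  simp only [Mx, nablaL, nablaR, h, boxM_add (qconj_mem hF) (qconj_mem hG), delL_add hF hG,
    delR_smul, delR_add (delL_mem hF) (delL_mem hG)]
  module

theorem Mx_smul (c : ℂ) (F : HCˣ → HC) : Mx (c • F) = c • Mx F := by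
  have h : (fun Z => qconj ((c • F) Z)) = c • fun Z => qconj (F Z) :=
    funext fun Z => qconj_smul _ _
  simp only [Mx, nablaL, nablaR, h, boxM_smul, delL_smul, delR_smul]
  module

theorem trDelBox_add {F G : HCˣ → HC} (hF : F ∈ W') (hG : G ∈ W') :
    trDelBox (F + G) = trDelBox F + trDelBox G := by
  funext Z
  simp only [trDelBox, boxM_add hF hG, delL_add (boxM_mem hF) (boxM_mem hG), Pi.add_apply,
    Matrix.trace_add]

theorem trDelBox_smul (c : ℂ) (F : HCˣ → HC) : trDelBox (c • F) = c • trDelBox F := by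
  funext Z
  simp only [trDelBox, boxM_smul, delL_smul, Pi.smul_apply, Matrix.trace_smul]

/-! ### The spaces `ker Mx` and `ℳ` -/

/-- `ker Mx = {F ∈ 𝒲' : Mx F = 0}`. -/
def kerMx : Submodule ℂ (HCˣ → HC) where
  carrier := {F | F ∈ W' ∧ Mx F = 0}
  add_mem' hF hG := ⟨W'.add_mem hF.1 hG.1, by rw [Mx_add hF.1 hG.1, hF.2, hG.2, add_zero]⟩
  zero_mem' := ⟨W'.zero_mem, by simpa using Mx_smul 0 0⟩
  smul_mem' c _ hF := ⟨W'.smul_mem c hF.1, by rw [Mx_smul, hF.2, smul_zero]⟩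

/-- `ℳ = {F ∈ 𝒲' : Mx F = 0, Tr(∂ ∘ □ F) = 0}`. -/
def calM : Submodule ℂ (HCˣ → HC) where
  carrier := {F | F ∈ W' ∧ Mx F = 0 ∧ trDelBox F = 0}
  add_mem' hF hG := ⟨W'.add_mem hF.1 hG.1,
    by rw [Mx_add hF.1 hG.1, hF.2.1, hG.2.1, add_zero],
    by rw [trDelBox_add hF.1 hG.1, hF.2.2, hG.2.2, add_zero]⟩
  zero_mem' := ⟨W'.zero_mem, by simpa using Mx_smul 0 0, by simpa using trDelBox_smul 0 0⟩
  smul_mem' c _ hF := ⟨W'.smul_mem c hF.1, by rw [Mx_smul, hF.2.1, smul_zero],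
    by rw [trDelBox_smul, hF.2.2, smul_zero]⟩

/-- `F` is harmonic: `□F = 0`. -/
def IsHarmonic (F : HCˣ → HC) : Prop := boxM F = 0

/-- `F` is biharmonic: `(□ ∘ □)F = 0`. -/
def IsBiharmonic (F : HCˣ → HC) : Prop := boxM (boxM F) = 0

/-- `F` is homogeneous of degree `d`: `F(cZ) = c^d F(Z)` for all `c ∈ ℂ^×`. -/
def IsHomogeneous (d : ℤ) (F : HCˣ → HC) : Prop :=
  ∀ (c : ℂˣ) (Z : HCˣ), F (c • Z) = (c : ℂ) ^ d • F Z

/-- The function `N(Z)^k · Z`. -/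
def NpowZ (k : ℤ) : HCˣ → HC := fun Z => N (Z : HC) ^ k • (Z : HC)

/-- The function `A(Z) + N(Z)/(d+1) · (∂A(Z)∂)⁺`. -/
def formA (d : ℤ) (A : HCˣ → HC) : HCˣ → HC := fun Z =>
  A Z + (N (Z : HC) / ((d : ℂ) + 1)) • qconj (delR (delL A) Z)

/-! ### The action `ρ'₂` -/

/-- The Lie algebra `𝔤𝔩(2, ℍ_ℂ)`: all `2 × 2` matrices with entries in `ℍ_ℂ`. -/
abbrev gl2HC : Type := Matrix (Fin 2) (Fin 2) HC

/-- The group `GL(2, ℍ_ℂ)`. -/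
abbrev GL2HC : Type := gl2HCˣ

/-- The action of `h = (a' b'; c' d') ∈ GL(2, ℍ_ℂ)`, `h⁻¹ = (a b; c d)`, on functions:
`(ρ'₂(h)F)(Z) = (a'-Zc')/N(a'-Zc') · F((aZ+b)(cZ+d)⁻¹) · (cZ+d)/N(cZ+d)`,
meaningful at the points `Z` where everything is invertible. -/
def rho2'Group (h : GL2HC) (F : HCˣ → HC) (Z : HCˣ) : HC :=
  let a' : HC := (h : gl2HC) 0 0
  let c' : HC := (h : gl2HC) 1 0
  let a : HC := (↑h⁻¹ : gl2HC) 0 0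
  let b : HC := (↑h⁻¹ : gl2HC) 0 1
  let c : HC := (↑h⁻¹ : gl2HC) 1 0
  let d : HC := (↑h⁻¹ : gl2HC) 1 1
  ((N (a' - Z * c'))⁻¹ • (a' - Z * c')) *
    Function.extend Units.val F 0 ((a * Z + b) * (c * Z + d)⁻¹) *
    ((N (c * Z + d))⁻¹ • (c * Z + d))

theorem exp_mul_exp_neg (X : gl2HC) : NormedSpace.exp X * NormedSpace.exp (-X) = 1 := by
  let _ : NormedRing HC := Matrix.linftyOpNormedRing
  let _ : NormedAlgebra ℚ HC := Matrix.linftyOpNormedAlgebra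
  let _ : NormedSpace ℂ HC := Matrix.linftyOpNormedSpace
  have _ := FiniteDimensional.complete ℂ HC
  have h := Matrix.exp_add_of_commute X (-X) (Commute.neg_right (Commute.refl X))
  rw [add_neg_cancel, NormedSpace.exp_zero] at h
  exact h.symm

/-- The exponential map `𝔤𝔩(2, ℍ_ℂ) → GL(2, ℍ_ℂ)`. -/
def expGL (X : gl2HC) : GL2HC where
  val := NormedSpace.exp X
  inv := NormedSpace.exp (-X)
  val_inv := exp_mul_exp_neg X
  inv_val := by simpa using exp_mul_exp_neg (-X)

/-- The Lie algebra action obtained by differentiating the group action: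
`(ρ'₂(X)F)(Z) = d/dt (ρ'₂(exp(tX))F)(Z)` at `t = 0`, entry by entry. -/
def rho2' (X : gl2HC) (F : HCˣ → HC) : HCˣ → HC := fun Z =>
  Matrix.of fun i j => deriv (fun t : ℂ => rho2'Group (expGL (t • X)) F Z i j) 0

/-- `V` is invariant under the `ρ'₂` action of `𝔤𝔩(2, ℍ_ℂ)`. -/
def IsRho2'Invariant (V : Submodule ℂ (HCˣ → HC)) : Prop :=
  ∀ (X : gl2HC), ∀ F ∈ V, rho2' X F ∈ V

end QuatAnalysis

end

open QuatAnalysis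

noncomputable section

namespace QuatAnalysis

/-! ### The differential algebra of polynomial functions -/

/-! Write q = Tr(∂F) (`dv F`) and let `lap` be □/4. Since the entries of ∂ commute, the
Cayley–Hamilton identity XFX = Tr(XF)X - det(X)F⁺ applies to X = ∂ and gives ∂F∂ = ∂q - lap F⁺.
Hence Mx F = 0 says exactly that (∂q)⁺ = 2 lap F (`isMaxwell_iff`), and membership in ℳ adds lap q =
0.

Biharmonic elements. Applying `lap` once more shows that a solution is biharmonic iff all
derivatives of lap q vanish, that is, iff lap q is constant (`IsMaxwell.isBiharmonic_iff`,
`exists_eq_of_D_eq_zero`). The constant is 12 for N(Z)Z, so this line complements ℳ.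

Generators. The algebra is graded by degree and the operators are homogeneous, so each homogeneous
component of an element of ℳ lies in ℳ. In degree d ≠ 0, -1, Euler's identity gives lap(N(∂q)⁺) =
d(∂q)⁺ = 2d lap F. So A = F - N(∂q)⁺/(2d) is harmonic, and its divergence (d+1)q/(2d) recovers F
from A. In degrees 0 and -1, q is harmonic of degree -1 and -2 respectively. The first kind vanishes
and the second is a multiple of N⁻¹, by a descent on the power of N in the denominator
(`eq_zero_of_lap_of_mem_Hom`, `exists_eq_of_lap_of_mem_Hom`).

Invariance. The Lie algebra acts by Lie derivatives along conformal vector fields ξ with dξ(E) = PE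
+ EQ (`rho2'_ev`). These preserve the Maxwell equation, and on its solutions lap q transforms into
ξ(lap q) + 2(Tr P + Tr Q) lap q (`IsConformal.lap_dv_lieD`), so lap q = 0 is preserved. In an
invariant biharmonic space both lap q and its transform are constant. Since Tr P + Tr Q is not
constant for a suitable ξ, this forces lap q = 0. -/

/-- The partial derivative `∂_{ij}` as a derivation of the algebra of polynomial functions. -/
def D (i j : Fin 2) : Derivation ℂ Sh Sh :=
  Derivation.mk'
    { toFun := fun f => ⟨pd i j f, pd_mem f.2 i j⟩
      map_add' := fun f g => Subtype.ext (pd_add_of_mem f.2 g.2 i j)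
      map_smul' := fun c f => Subtype.ext (pd_smul c f i j) }
    (fun f g => Subtype.ext <| by
      have h := pd_mul (hasPd_of_mem f.2) (hasPd_of_mem g.2) i j
      change pd i j ((f : HCˣ → ℂ) * g) = (f : HCˣ → ℂ) * pd i j g + (g : HCˣ → ℂ) * pd i j f
      rw [h]; ring)

@[simp] theorem coe_D (i j : Fin 2) (f : Sh) : ((D i j f : Sh) : HCˣ → ℂ) = pd i j f := rfl

/-- The coordinate function `z_{kl}`. -/
def z (k l : Fin 2) : Sh := ⟨_, coord_mem_Sh k l⟩

/-- The norm `N(Z)` as a polynomial function. -/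
def n : Sh := z 0 0 * z 1 1 - z 0 1 * z 1 0

/-- The inverse norm `N(Z)⁻¹` as a polynomial function. -/
def ni : Sh := ⟨_, invN_mem_Sh⟩

theorem n_apply (Z : HCˣ) : (n : HCˣ → ℂ) Z = N (Z : HC) := (Matrix.det_fin_two _).symm

theorem n_mul_ni : n * ni = 1 := Subtype.ext <| funext fun Z => by
  change (n : HCˣ → ℂ) Z * (N (Z : HC))⁻¹ = 1
  rw [n_apply, mul_inv_cancel₀ (N_unit_ne_zero Z)]

theorem D_z (i j k l : Fin 2) : D i j (z k l) = if i = k ∧ j = l then 1 else 0 := by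
  have key : ∀ Z : HCˣ, HasDerivAt
      (fun t : ℂ => Function.extend Units.val (fun Z : HCˣ => (Z : HC) k l) 0
        ((Z : HC) + t • Matrix.single i j 1)) ((Matrix.single i j 1 : HC) k l) 0 :=
    fun Z => (hasDerivAt_entry Z i j k l).congr_of_eventuallyEq
      (extend_eventuallyEq _ (fun Z : HC => Z k l) (fun _ => rfl) Z _)
  refine Subtype.ext (funext fun Z => (key Z).deriv.trans ?_)
  rw [Matrix.single_apply]
  split_ifs <;> rfl

theorem D_ni (i j : Fin 2) : D i j ni = -(ni * ni * D i j n) := by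
  have h : D i j (n * ni) = 0 := by rw [n_mul_ni]; exact (D i j).map_one_eq_zero
  rw [Derivation.leibniz, smul_eq_mul, smul_eq_mul] at h
  linear_combination ni * h - D i j ni * n_mul_ni

theorem Sh_induction {p : Sh → Prop} (hz : ∀ k l, p (z k l)) (hni : p ni)
    (hc : ∀ c : ℂ, p (algebraMap ℂ Sh c)) (hadd : ∀ f g, p f → p g → p (f + g))
    (hmul : ∀ f g, p f → p g → p (f * g)) (f : Sh) : p f := by
  obtain ⟨f, hf⟩ := f
  induction hf using Algebra.adjoin_induction with
  | mem f hf =>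
    rcases hf with ⟨⟨k, l⟩, rfl⟩ | hf
    · exact hz k l
    · rw [Set.mem_singleton_iff] at hf; subst hf; exact hni
  | algebraMap c => exact hc c
  | add f g _ _ hf hg => exact hadd _ _ hf hg
  | mul f g _ _ hf hg => exact hmul _ _ hf hg

/-- The commutator of two derivations is again a derivation, so it suffices that it kills the
generators. For `ni` this follows by applying it to `n * ni = 1`. -/
theorem D_comm (i j k l : Fin 2) (f : Sh) : D i j (D k l f) = D k l (D i j f) := by
  suffices h : ⁅D i j, D k l⁆ f = 0 by
    rwa [Derivation.commutator_apply, sub_eq_zero] at h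
  have hz : ∀ a b, ⁅D i j, D k l⁆ (z a b) = 0 := fun a b => by
    rw [Derivation.commutator_apply, D_z, D_z]
    split_ifs <;> simp
  have hn : ⁅D i j, D k l⁆ n = 0 := by
    simp only [n, map_sub, Derivation.leibniz, hz, smul_zero, add_zero, sub_zero]
  induction f using Sh_induction with
  | hz a b => exact hz a b
  | hni =>
    have h : ⁅D i j, D k l⁆ (n * ni) = 0 := by
      rw [n_mul_ni]; exact Derivation.map_one_eq_zero _
    rw [Derivation.leibniz, hn, smul_zero, add_zero, smul_eq_mul] at h
    linear_combination ni * h - ⁅D i j, D k l⁆ ni * n_mul_ni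
  | hc c => exact Derivation.map_algebraMap _ c
  | hadd f g hf hg => rw [map_add, hf, hg, add_zero]
  | hmul f g hf hg => rw [Derivation.leibniz, hf, hg, smul_zero, smul_zero, add_zero]

@[simp] theorem D_two (i j : Fin 2) : D i j 2 = 0 := (D i j).map_natCast 2

theorem D_comm_01_00 (f : Sh) : D 0 1 (D 0 0 f) = D 0 0 (D 0 1 f) := D_comm ..
theorem D_comm_10_00 (f : Sh) : D 1 0 (D 0 0 f) = D 0 0 (D 1 0 f) := D_comm ..
theorem D_comm_11_00 (f : Sh) : D 1 1 (D 0 0 f) = D 0 0 (D 1 1 f) := D_comm ..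
theorem D_comm_10_01 (f : Sh) : D 1 0 (D 0 1 f) = D 0 1 (D 1 0 f) := D_comm ..
theorem D_comm_11_01 (f : Sh) : D 1 1 (D 0 1 f) = D 0 1 (D 1 1 f) := D_comm ..
theorem D_comm_11_10 (f : Sh) : D 1 1 (D 1 0 f) = D 1 0 (D 1 1 f) := D_comm ..

theorem D_mul (i j : Fin 2) (f g : Sh) : D i j (f * g) = f * D i j g + g * D i j f :=
  (D i j).leibniz f g

/-! ### The Maxwell equation and its conformal symmetries. -/

/-- Matrices of polynomial functions. -/
abbrev MS : Type := Matrix (Fin 2) (Fin 2) Sh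

/-- The divergence `Tr(∂F) = ∑ ∂_{ij} F_{ij}`. -/
def dv (F : MS) : Sh := D 0 0 (F 0 0) + D 0 1 (F 0 1) + D 1 0 (F 1 0) + D 1 1 (F 1 1)

/-- The operator `∂₁₁∂₂₂ - ∂₁₂∂₂₁ = □/4`. -/
def lap (f : Sh) : Sh := D 0 0 (D 1 1 f) - D 0 1 (D 1 0 f)

/-- The equation `∂ Tr(∂F) = 2 (□/4) F⁺`, equivalent to `Mx F = 0`. -/
structure IsMaxwell (F : MS) : Prop where
  e00 : D 0 0 (dv F) = 2 * lap (F 1 1)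
  e01 : D 0 1 (dv F) = -(2 * lap (F 1 0))
  e10 : D 1 0 (dv F) = -(2 * lap (F 0 1))
  e11 : D 1 1 (dv F) = 2 * lap (F 0 0)

/-- The Lie derivative along the vector field `ξ` with `dξ(E) = P E + E Q`,
acting on matrices of functions. -/
def lieD (P Q ξ F : MS) : MS := Matrix.of fun a b =>
  ξ 0 0 * D 0 0 (F a b) + ξ 0 1 * D 0 1 (F a b) + ξ 1 0 * D 1 0 (F a b) + ξ 1 1 * D 1 1 (F a b)
    + (P.adjugate * F) a b + (F * Q.adjugate) a b

/-- The vector field `ξ` satisfies `dξ(E) = P E + E Q`, with `dP(E) = E C` and `dQ(E) = C E` for a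
constant matrix `C`. -/
structure IsConformal (C P Q ξ : MS) : Prop where
  dC : ∀ i j k l, D i j (C k l) = 0
  dP : ∀ i j k l, D i j (P k l) = if i = k then C j l else 0
  dQ : ∀ i j k l, D i j (Q k l) = if j = l then C k i else 0
  dξ : ∀ i j k l, D i j (ξ k l) = (if j = l then P k i else 0) + if i = k then Q j l else 0

/-- The divergence is covariant only up to the term -2 Tr(CF), which comes from differentiating P
and Q. This term vanishes for affine vector fields. -/
theorem IsConformal.dv_lieD {C P Q ξ : MS} (h : IsConformal C P Q ξ) (F : MS) :
    dv (lieD P Q ξ F) = ξ 0 0 * D 0 0 (dv F) + ξ 0 1 * D 0 1 (dv F) + ξ 1 0 * D 1 0 (dv F)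
      + ξ 1 1 * D 1 1 (dv F) + (P 0 0 + P 1 1 + Q 0 0 + Q 1 1) * dv F
      - 2 * (C 0 0 * F 0 0 + C 0 1 * F 1 0 + C 1 0 * F 0 1 + C 1 1 * F 1 1) := by
  simp [dv, lieD, Matrix.adjugate_fin_two, Matrix.mul_apply, h.dP, h.dQ, h.dξ,
    D_comm_01_00, D_comm_10_00, D_comm_11_00, D_comm_10_01, D_comm_11_01, D_comm_11_10]
  ring

/-- Applying `lap` to the anomalous term gives -2 Tr(C lap F). By the Maxwell equation this is first
order in `dv F`, and it cancels the first-order terms produced by the second derivatives of ξ and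
the first derivatives of P and Q. -/
theorem IsConformal.lap_dv_lieD {C P Q ξ : MS} (h : IsConformal C P Q ξ) {F : MS}
    (hF : IsMaxwell F) :
    lap (dv (lieD P Q ξ F)) = ξ 0 0 * D 0 0 (lap (dv F)) + ξ 0 1 * D 0 1 (lap (dv F))
      + ξ 1 0 * D 1 0 (lap (dv F)) + ξ 1 1 * D 1 1 (lap (dv F))
      + 2 * (P 0 0 + P 1 1 + Q 0 0 + Q 1 1) * lap (dv F) := by
  rw [h.dv_lieD]
  obtain ⟨h1, h2, h3, h4⟩ := hF
  generalize dv F = p at *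
  simp [lap, h.dP, h.dQ, h.dξ, h.dC,
    D_comm_01_00, D_comm_10_00, D_comm_11_00, D_comm_10_01, D_comm_11_01, D_comm_11_10] at *
  linear_combination C 0 0 * h4 - C 1 0 * h3 - C 0 1 * h2 + C 1 1 * h1

/-- The Maxwell equation transforms as a tensor. This component for the Lie derivative of F is the
ξ-derivative of the same component for F, plus its multiple by Tr P + Tr Q, plus components mixed by
the entries of P and Q. The next three lemmas have the same structure. -/
theorem IsConformal.lieD_e00 {C P Q ξ : MS} (h : IsConformal C P Q ξ) {F : MS}
    (hF : IsMaxwell F) :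
    D 0 0 (dv (lieD P Q ξ F)) = 2 * lap (lieD P Q ξ F 1 1) := by
  have d (k l : Fin 2) := congrArg (D k l) hF.e00
  have d00 := d 0 0
  have d01 := d 0 1
  have d10 := d 1 0
  have d11 := d 1 1
  obtain ⟨e00, e01, e10, e11⟩ := hF
  rw [h.dv_lieD]
  simp [lap, dv, lieD, Matrix.adjugate_fin_two, Matrix.mul_apply, h.dP, h.dQ, h.dξ, h.dC,
    D_comm_01_00, D_comm_10_00, D_comm_11_00, D_comm_10_01, D_comm_11_01, D_comm_11_10]
    at d00 d01 d10 d11 e00 e01 e10 e11 ⊢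
  linear_combination ξ 0 0 * d00 + ξ 0 1 * d01 + ξ 1 0 * d10 + ξ 1 1 * d11
    + (P 0 0 + P 1 1 + Q 0 0 + Q 1 1) * e00 + P 0 0 * e00 + P 1 0 * e10
    + Q 0 0 * e00 + Q 0 1 * e01

theorem IsConformal.lieD_e01 {C P Q ξ : MS} (h : IsConformal C P Q ξ) {F : MS}
    (hF : IsMaxwell F) :
    D 0 1 (dv (lieD P Q ξ F)) = -(2 * lap (lieD P Q ξ F 1 0)) := by
  have d (k l : Fin 2) := congrArg (D k l) hF.e01
  have d00 := d 0 0
  have d01 := d 0 1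
  have d10 := d 1 0
  have d11 := d 1 1
  obtain ⟨e00, e01, e10, e11⟩ := hF
  rw [h.dv_lieD]
  simp [lap, dv, lieD, Matrix.adjugate_fin_two, Matrix.mul_apply, h.dP, h.dQ, h.dξ, h.dC,
    D_comm_01_00, D_comm_10_00, D_comm_11_00, D_comm_10_01, D_comm_11_01, D_comm_11_10]
    at d00 d01 d10 d11 e00 e01 e10 e11 ⊢
  linear_combination ξ 0 0 * d00 + ξ 0 1 * d01 + ξ 1 0 * d10 + ξ 1 1 * d11
    + (P 0 0 + P 1 1 + Q 0 0 + Q 1 1) * e01 + P 0 0 * e01 + P 1 0 * e11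
    + Q 1 0 * e00 + Q 1 1 * e01

theorem IsConformal.lieD_e10 {C P Q ξ : MS} (h : IsConformal C P Q ξ) {F : MS}
    (hF : IsMaxwell F) :
    D 1 0 (dv (lieD P Q ξ F)) = -(2 * lap (lieD P Q ξ F 0 1)) := by
  have d (k l : Fin 2) := congrArg (D k l) hF.e10
  have d00 := d 0 0
  have d01 := d 0 1
  have d10 := d 1 0
  have d11 := d 1 1
  obtain ⟨e00, e01, e10, e11⟩ := hF
  rw [h.dv_lieD]
  simp [lap, dv, lieD, Matrix.adjugate_fin_two, Matrix.mul_apply, h.dP, h.dQ, h.dξ, h.dC,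
    D_comm_01_00, D_comm_10_00, D_comm_11_00, D_comm_10_01, D_comm_11_01, D_comm_11_10]
    at d00 d01 d10 d11 e00 e01 e10 e11 ⊢
  linear_combination ξ 0 0 * d00 + ξ 0 1 * d01 + ξ 1 0 * d10 + ξ 1 1 * d11
    + (P 0 0 + P 1 1 + Q 0 0 + Q 1 1) * e10 + P 0 1 * e00 + P 1 1 * e10
    + Q 0 0 * e10 + Q 0 1 * e11

theorem IsConformal.lieD_e11 {C P Q ξ : MS} (h : IsConformal C P Q ξ) {F : MS}
    (hF : IsMaxwell F) :
    D 1 1 (dv (lieD P Q ξ F)) = 2 * lap (lieD P Q ξ F 0 0) := by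
  have d (k l : Fin 2) := congrArg (D k l) hF.e11
  have d00 := d 0 0
  have d01 := d 0 1
  have d10 := d 1 0
  have d11 := d 1 1
  obtain ⟨e00, e01, e10, e11⟩ := hF
  rw [h.dv_lieD]
  simp [lap, dv, lieD, Matrix.adjugate_fin_two, Matrix.mul_apply, h.dP, h.dQ, h.dξ, h.dC,
    D_comm_01_00, D_comm_10_00, D_comm_11_00, D_comm_10_01, D_comm_11_01, D_comm_11_10]
    at d00 d01 d10 d11 e00 e01 e10 e11 ⊢
  linear_combination ξ 0 0 * d00 + ξ 0 1 * d01 + ξ 1 0 * d10 + ξ 1 1 * d11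
    + (P 0 0 + P 1 1 + Q 0 0 + Q 1 1) * e11 + P 0 1 * e01 + P 1 1 * e11
    + Q 1 0 * e10 + Q 1 1 * e11

theorem IsConformal.isMaxwell_lieD {C P Q ξ : MS} (h : IsConformal C P Q ξ) {F : MS}
    (hF : IsMaxwell F) : IsMaxwell (lieD P Q ξ F) :=
  ⟨h.lieD_e00 hF, h.lieD_e01 hF, h.lieD_e10 hF, h.lieD_e11 hF⟩

/-! ### Matrices of polynomial functions as elements of `𝒲'` -/

/-- The element of `𝒲'` defined by a matrix of polynomial functions. -/
def ev : MS →ₗ[ℂ] (HCˣ → HC) where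
  toFun F := fun Z => Matrix.of fun a b => (F a b : HCˣ → ℂ) Z
  map_add' _ _ := rfl
  map_smul' _ _ := rfl

theorem ev_apply (F : MS) (Z : HCˣ) (a b : Fin 2) : ev F Z a b = (F a b : HCˣ → ℂ) Z := rfl

theorem ev_mem (F : MS) : ev F ∈ W' := fun i j => (F i j).2

theorem exists_ev {F : HCˣ → HC} (hF : F ∈ W') : ∃ G : MS, ev G = F :=
  ⟨Matrix.of fun a b => ⟨_, hF a b⟩, rfl⟩

theorem ev_injective : Function.Injective ev := fun F G h => by
  refine Matrix.ext fun a b => Subtype.ext (funext fun Z => ?_)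
  exact congrFun (congrFun (congrFun h Z) a) b

theorem ev_eq_zero_iff {F : MS} : ev F = 0 ↔ F = 0 :=
  ⟨fun h => ev_injective (h.trans (map_zero ev).symm), fun h => h ▸ map_zero ev⟩

theorem delL_ev (F : MS) :
    delL (ev F) = ev (Matrix.of fun a b => D 0 a (F 0 b) + D 1 a (F 1 b)) := by
  funext Z; ext a b
  exact Fin.sum_univ_two fun k => pd k a (fun Y => ev F Y k b) Z

theorem delR_ev (F : MS) :
    delR (ev F) = ev (Matrix.of fun a b => D b 0 (F a 0) + D b 1 (F a 1)) := by
  funext Z; ext a b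
  exact Fin.sum_univ_two fun k => pd b k (fun Y => ev F Y a k) Z

theorem qconj_ev (F : MS) : (fun Z => qconj (ev F Z)) = ev F.adjugate := by
  funext Z; ext a b
  simp only [qconj, Matrix.adjugate_fin_two, ev_apply]
  fin_cases a <;> fin_cases b <;> rfl

theorem boxM_ev (F : MS) : boxM (ev F) = ev (Matrix.of fun a b => 4 * lap (F a b)) := rfl

/-- This is XFX = Tr(XF)X - det(X)F⁺ for X = ∂, whose entries commute and whose determinant is
`lap`. -/
theorem delR_delL_ev (F : MS) :
    delR (delL (ev F)) = ev (Matrix.of fun a b => D b a (dv F) - lap (F.adjugate a b)) := by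
  rw [delL_ev, delR_ev]
  congr 1
  refine Matrix.ext fun a b => ?_
  simp only [Matrix.of_apply, Matrix.adjugate_fin_two]
  fin_cases a <;> fin_cases b <;>
  simp [dv, lap, D_comm_01_00, D_comm_10_00, D_comm_11_00, D_comm_10_01, D_comm_11_01,
    D_comm_11_10] <;> ring1

theorem two_mul_eq_smul (f : Sh) : 2 * f = (2 : ℂ) • f := by rw [Algebra.smul_def]; rfl

theorem Mx_ev (F : MS) :
    Mx (ev F) = ev (Matrix.of fun a b => 4 * (D b a (dv F) - 2 * lap (F.adjugate a b))) := by
  rw [Mx, nablaL, nablaR, delR_smul, delR_delL_ev, qconj_ev, boxM_ev, ← map_smul, ← map_smul,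
    ← map_sub]
  congr 1
  refine Matrix.ext fun a b => ?_
  simp only [Matrix.sub_apply, Matrix.smul_apply, Matrix.of_apply, ← two_mul_eq_smul]
  ring1

theorem four_mul_eq_zero {f : Sh} : 4 * f = 0 ↔ f = 0 := by
  have h : (4 : Sh) * f = (4 : ℂ) • f := by rw [Algebra.smul_def]; rfl
  rw [h, smul_eq_zero_iff_right (by norm_num)]

theorem lap_neg (f : Sh) : lap (-f) = -lap f := by
  simp only [lap, map_neg]; ring1

theorem Mx_ev_eq_zero_iff {F : MS} : Mx (ev F) = 0 ↔ IsMaxwell F := by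
  rw [Mx_ev, ev_eq_zero_iff, ← Matrix.ext_iff]
  simp only [Matrix.of_apply, Matrix.zero_apply, four_mul_eq_zero, sub_eq_zero,
    Fin.forall_fin_two, Matrix.adjugate_fin_two]
  simp only [Matrix.cons_val', Matrix.cons_val_zero, Matrix.cons_val_one,
    Matrix.cons_val_fin_one, lap_neg]
  constructor
  · rintro ⟨⟨h00, h10⟩, h01, h11⟩
    exact ⟨h00, by linear_combination h01, by linear_combination h10, h11⟩
  · rintro ⟨h00, h01, h10, h11⟩
    exact ⟨⟨h00, by linear_combination h10⟩, by linear_combination h01, h11⟩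

theorem lap_add (f g : Sh) : lap (f + g) = lap f + lap g := by
  simp only [lap, map_add]; ring1

theorem lap_smul (c : ℂ) (f : Sh) : lap (c • f) = c • lap f := by
  simp only [lap, Derivation.map_smul, smul_sub]

theorem D_lap (i j : Fin 2) (f : Sh) : D i j (lap f) = lap (D i j f) := by
  simp only [lap, map_sub, D_comm i j]

@[simp] theorem D_four (i j : Fin 2) : D i j 4 = 0 := (D i j).map_natCast 4

theorem lap_four_mul (f : Sh) : lap (4 * f) = 4 * lap f := by
  simp [lap]; ring1

theorem trDelBox_ev_eq_zero_iff {F : MS} : trDelBox (ev F) = 0 ↔ lap (dv F) = 0 := by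
  have h : trDelBox (ev F) = ((4 * lap (dv F) : Sh) : HCˣ → ℂ) := by
    have h2 : 4 * lap (dv F) = D 0 0 (4 * lap (F 0 0)) + D 1 0 (4 * lap (F 1 0))
        + (D 0 1 (4 * lap (F 0 1)) + D 1 1 (4 * lap (F 1 1))) := by
      simp only [← lap_four_mul, D_lap, ← lap_add]
      congr 1
      simp only [dv, D_mul, D_four]
      ring
    rw [h2]
    funext Z
    rw [trDelBox, boxM_ev, delL_ev, Matrix.trace_fin_two]
    rfl
  rw [h, ← four_mul_eq_zero, ← Subtype.coe_inj]; rfl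

theorem isHarmonic_ev_iff {F : MS} : IsHarmonic (ev F) ↔ ∀ a b, lap (F a b) = 0 := by
  rw [IsHarmonic, boxM_ev, ev_eq_zero_iff, ← Matrix.ext_iff]
  simp only [Matrix.of_apply, Matrix.zero_apply, four_mul_eq_zero]

theorem isBiharmonic_ev_iff {F : MS} : IsBiharmonic (ev F) ↔ ∀ a b, lap (lap (F a b)) = 0 := by
  rw [IsBiharmonic, boxM_ev]
  refine isHarmonic_ev_iff.trans ?_
  simp only [Matrix.of_apply, lap_four_mul, four_mul_eq_zero]

theorem ev_mem_kerMx_iff {F : MS} : ev F ∈ kerMx ↔ IsMaxwell F :=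
  (and_iff_right (ev_mem F)).trans Mx_ev_eq_zero_iff

theorem ev_mem_calM_iff {F : MS} : ev F ∈ calM ↔ IsMaxwell F ∧ lap (dv F) = 0 :=
  (and_iff_right (ev_mem F)).trans (and_congr Mx_ev_eq_zero_iff trDelBox_ev_eq_zero_iff)

theorem two_mul_eq_zero {f : Sh} : 2 * f = 0 ↔ f = 0 := by
  rw [two_mul_eq_smul, smul_eq_zero_iff_right (by norm_num)]

theorem lap_two_mul (f : Sh) : lap (2 * f) = 2 * lap f := by
  simp [lap]; ring1

/-- A solution of the Maxwell equation is biharmonic iff `□ Tr(∂F)` is constant. -/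
theorem IsMaxwell.isBiharmonic_iff {F : MS} (hF : IsMaxwell F) :
    IsBiharmonic (ev F) ↔ ∀ i j, D i j (lap (dv F)) = 0 := by
  -- By the Maxwell equation, each derivative of `lap (dv F)` is twice, up to sign, `lap (lap _)` of
  -- one entry of `F`.
  simp only [isBiharmonic_ev_iff, Fin.forall_fin_two, D_lap, hF.e00, hF.e01, hF.e10, hF.e11,
    lap_two_mul, lap_neg, neg_eq_zero, two_mul_eq_zero]
  tauto

/-! ### The action `ρ'₂` as a Lie derivative -/

/-- The matrix-valued curve `γ` has the derivative `E` at `0`, entry by entry. -/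
def HasMatDeriv (γ : ℂ → HC) (E : HC) : Prop :=
  ∀ k l, HasDerivAt (fun t => γ t k l) (E k l) 0

namespace HasMatDeriv

variable {γ δ : ℂ → HC} {E G : HC}

theorem const (Z : HC) : HasMatDeriv (fun _ => Z) 0 := fun k l => hasDerivAt_const 0 (Z k l)

theorem add (hγ : HasMatDeriv γ E) (hδ : HasMatDeriv δ G) :
    HasMatDeriv (fun t => γ t + δ t) (E + G) := fun k l => (hγ k l).add (hδ k l)

theorem sub (hγ : HasMatDeriv γ E) (hδ : HasMatDeriv δ G) :
    HasMatDeriv (fun t => γ t - δ t) (E - G) := fun k l => (hγ k l).sub (hδ k l)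

theorem mul (hγ : HasMatDeriv γ E) (hδ : HasMatDeriv δ G) :
    HasMatDeriv (fun t => γ t * δ t) (E * δ 0 + γ 0 * G) := fun k l => by
  simp only [Matrix.mul_apply, Matrix.add_apply, Fin.sum_univ_two]
  refine (((hγ k 0).mul (hδ 0 l)).add ((hγ k 1).mul (hδ 1 l))).congr_deriv ?_
  ring

theorem smul {f : ℂ → ℂ} {f' : ℂ} (hf : HasDerivAt f f' 0) (hγ : HasMatDeriv γ E) :
    HasMatDeriv (fun t => f t • γ t) (f' • γ 0 + f 0 • E) := fun k l => hf.mul (hγ k l)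

theorem adjugate (hγ : HasMatDeriv γ E) : HasMatDeriv (fun t => (γ t).adjugate) E.adjugate := by
  intro k l
  simp only [Matrix.adjugate_fin_two]
  fin_cases k <;> fin_cases l
  · exact hγ 1 1
  · exact (hγ 0 1).neg
  · exact (hγ 1 0).neg
  · exact hγ 0 0

theorem inv_N (hγ : HasMatDeriv γ E) (h1 : γ 0 = 1) :
    HasDerivAt (fun t => (N (γ t))⁻¹) (-E.trace) 0 := by
  have h : HasDerivAt (fun t => N (γ t)) E.trace 0 := by
    simp only [N, Matrix.det_fin_two, Matrix.trace_fin_two]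
    refine (((hγ 0 0).mul (hγ 1 1)).sub ((hγ 0 1).mul (hγ 1 0))).congr_deriv ?_
    simp [h1]
  have h0 : N (γ 0) = 1 := by rw [h1, N, Matrix.det_one]
  refine (h.inv (by rw [h0]; exact one_ne_zero)).congr_deriv ?_
  rw [h0]; simp

theorem inv (hγ : HasMatDeriv γ E) (h1 : γ 0 = 1) : HasMatDeriv (fun t => (γ t)⁻¹) (-E) := by
  simp only [Matrix.inv_def, Ring.inverse_eq_inv']
  refine fun k l => (smul (hγ.inv_N h1) hγ.adjugate k l).congr_deriv ?_
  rw [h1]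
  simp only [N, Matrix.det_one]
  revert k l
  refine fun k l => congrFun (congrFun ?_ k) l
  ext k l
  fin_cases k <;> fin_cases l <;> simp [Matrix.adjugate_fin_two, Matrix.trace_fin_two]

/-- Where γ is invertible, γ/N(γ) is the inverse of γ⁺, so its derivative at the identity is -E⁺.
This is the source of the adjugates in `lieD`. -/
theorem inv_N_smul (hγ : HasMatDeriv γ E) (h1 : γ 0 = 1) :
    HasMatDeriv (fun t => (N (γ t))⁻¹ • γ t) (-E.adjugate) := by
  convert smul (hγ.inv_N h1) hγ using 1
  rw [h1]
  simp only [N, Matrix.det_one]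
  ext k l
  fin_cases k <;> fin_cases l <;> simp [Matrix.adjugate_fin_two, Matrix.trace_fin_two]

theorem eventually_isUnit (hγ : HasMatDeriv γ E) {Z : HCˣ} (hZ : γ 0 = Z) :
    ∀ᶠ t in nhds 0, IsUnit (γ t) := by
  have hc : ContinuousAt (fun t => (γ t).det) 0 := by
    simp only [Matrix.det_fin_two]
    exact ((hγ 0 0).continuousAt.mul (hγ 1 1).continuousAt).sub
      ((hγ 0 1).continuousAt.mul (hγ 1 0).continuousAt)
  filter_upwards [hc.eventually_ne (by rw [hZ]; exact N_unit_ne_zero Z)] with t ht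
  exact (Matrix.isUnit_iff_isUnit_det _).2 (isUnit_iff_ne_zero.2 ht)

/-- The chain rule for polynomial functions. -/
theorem comp (hγ : HasMatDeriv γ E) {Z : HCˣ} (hZ : γ 0 = Z) (f : Sh) :
    HasDerivAt (fun t => Function.extend Units.val (f : HCˣ → ℂ) 0 (γ t))
      (∑ i, ∑ j, E i j * (D i j f : HCˣ → ℂ) Z) 0 := by
  have hu := hγ.eventually_isUnit hZ
  induction f using Sh_induction with
  | hz k l =>
    refine ((hγ k l).congr_of_eventuallyEq ?_).congr_deriv ?_
    · filter_upwards [hu] with t ht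
      obtain ⟨u, hu⟩ := ht
      rw [← hu, extend_unit]; rfl
    · simp only [D_z, Fin.sum_univ_two]
      fin_cases k <;> fin_cases l <;> simp
  | hni =>
    have h := (((hγ 0 0).mul (hγ 1 1)).sub ((hγ 0 1).mul (hγ 1 0))).inv (by
      have := N_unit_ne_zero Z
      simpa [N, ← hZ, Matrix.det_fin_two] using this)
    refine (h.congr_of_eventuallyEq ?_).congr_deriv ?_
    · filter_upwards [hu] with t ht
      obtain ⟨u, hu⟩ := ht
      rw [← hu, extend_unit]
      change (N (u : HC))⁻¹ = _
      rw [N, Matrix.det_fin_two, hu]; rfl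
    · have hn : ∀ i j, (D i j ni : HCˣ → ℂ) Z
          = -((N (Z : HC))⁻¹ * (N (Z : HC))⁻¹ * (D i j n : HCˣ → ℂ) Z) := fun i j => by
        rw [D_ni]; rfl
      simp only [hn, n, map_sub, D_mul, D_z, Fin.sum_univ_two]
      simp [hZ, N, Matrix.det_fin_two, z]
      rw [div_eq_mul_inv, ← inv_pow]
      ring
  | hc c =>
    refine ((hasDerivAt_const (0 : ℂ) c).congr_of_eventuallyEq ?_).congr_deriv ?_
    · filter_upwards [hu] with t ht
      obtain ⟨u, hu⟩ := ht
      rw [← hu, extend_unit]; rfl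
    · simp only [Derivation.map_algebraMap]
      simp
  | hadd f g hf hg =>
    refine ((hf.add hg).congr_of_eventuallyEq ?_).congr_deriv ?_
    · filter_upwards [hu] with t ht
      obtain ⟨u, hu⟩ := ht
      simp only [Pi.add_apply]
      rw [← hu, extend_unit, extend_unit, extend_unit]; rfl
    · simp only [map_add, Fin.sum_univ_two, Subalgebra.coe_add, Pi.add_apply]
      ring
  | hmul f g hf hg =>
    refine ((hf.mul hg).congr_of_eventuallyEq ?_).congr_deriv ?_
    · filter_upwards [hu] with t ht
      obtain ⟨u, hu⟩ := ht
      simp only [Pi.mul_apply]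
      rw [← hu, extend_unit, extend_unit, extend_unit]; rfl
    · simp only [hZ, extend_unit, D_mul, Fin.sum_univ_two, Subalgebra.coe_add, Pi.add_apply,
        Subalgebra.coe_mul, Pi.mul_apply]
      ring

theorem comp_ev (hγ : HasMatDeriv γ E) {Z : HCˣ} (hZ : γ 0 = Z) (F : MS) :
    HasMatDeriv (fun t => Function.extend Units.val (ev F) 0 (γ t))
      (∑ i, ∑ j, E i j • ev (F.map (D i j)) Z) := by
  intro k l
  refine ((hγ.comp hZ (F k l)).congr_of_eventuallyEq ?_).congr_deriv ?_
  · filter_upwards [hγ.eventually_isUnit hZ] with t ht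
    obtain ⟨u, hu⟩ := ht
    rw [← hu, extend_unit, extend_unit]; rfl
  · simp only [Fin.sum_univ_two, Matrix.add_apply, Matrix.smul_apply, smul_eq_mul]; rfl

end HasMatDeriv

theorem hasMatDeriv_exp (X : gl2HC) (i j : Fin 2) :
    HasMatDeriv (fun t => (NormedSpace.exp (t • X) : gl2HC) i j) (X i j) := by
  let _ : NormedRing HC := Matrix.linftyOpNormedRing
  let _ : NormedAlgebra ℂ HC := Matrix.linftyOpNormedAlgebra
  let _ : NormedRing gl2HC := Matrix.linftyOpNormedRing
  let _ : NormedAlgebra ℂ gl2HC := Matrix.linftyOpNormedAlgebra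
  have _ := FiniteDimensional.complete ℂ gl2HC
  have h := hasDerivAt_exp_smul_const (𝕂 := ℂ) X 0
  rw [zero_smul, NormedSpace.exp_zero, one_mul] at h
  intro k l
  let L : gl2HC →ₗ[ℂ] ℂ :=
    { toFun := fun Y => Y i j k l
      map_add' := fun _ _ => rfl
      map_smul' := fun _ _ => rfl }
  exact (LinearMap.toContinuousLinearMap L).hasFDerivAt.comp_hasDerivAt (0 : ℂ) h

/-! ### The conformal vector fields of 𝔤𝔩(2, ℍ_ℂ). -/

/-- The generic point as a matrix of functions. -/
def Zm : MS := Matrix.of z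

/-- Constant matrices. -/
def cm (A : HC) : MS := A.map (algebraMap ℂ Sh)

theorem D_cm (A : HC) (i j k l : Fin 2) : D i j (cm A k l) = 0 := Derivation.map_algebraMap _ _

theorem cm_apply (A : HC) (k l : Fin 2) (Z : HCˣ) : (cm A k l : HCˣ → ℂ) Z = A k l := rfl

theorem z_apply (k l : Fin 2) (Z : HCˣ) : (z k l : HCˣ → ℂ) Z = (Z : HC) k l := rfl

/-- The matrix `P = Z C - A` of the vector field of `X = (A B; C D)`. -/
def vP (X : gl2HC) : MS := Zm * cm (X 1 0) - cm (X 0 0)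

/-- The matrix `Q = C Z + D` of the vector field of `X = (A B; C D)`. -/
def vQ (X : gl2HC) : MS := cm (X 1 0) * Zm + cm (X 1 1)

/-- The vector field `Z C Z + Z D - A Z - B` of `X = (A B; C D)`. -/
def vξ (X : gl2HC) : MS :=
  Zm * cm (X 1 0) * Zm + Zm * cm (X 1 1) - cm (X 0 0) * Zm - cm (X 0 1)

theorem isConformal_vξ (X : gl2HC) : IsConformal (cm (X 1 0)) (vP X) (vQ X) (vξ X) where
  dC := D_cm _
  dP i j k l := by
    simp only [vP, Matrix.sub_apply, Matrix.mul_apply, Fin.sum_univ_two, map_sub, map_add, D_mul,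
      D_cm, Zm, Matrix.of_apply, D_z]
    fin_cases i <;> fin_cases j <;> fin_cases k <;> simp
  dQ i j k l := by
    simp only [vQ, Matrix.add_apply, Matrix.mul_apply, Fin.sum_univ_two, map_add, D_mul,
      D_cm, Zm, Matrix.of_apply, D_z]
    fin_cases i <;> fin_cases j <;> fin_cases l <;> simp
  dξ i j k l := by
    simp only [vξ, vP, vQ, Matrix.add_apply, Matrix.sub_apply, Matrix.mul_apply, Fin.sum_univ_two,
      map_add, map_sub, D_mul, D_cm, Zm, Matrix.of_apply, D_z]
    fin_cases i <;> fin_cases j <;> fin_cases k <;> fin_cases l <;> simp <;> ring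

/-- At t = 0 the two outer factors of the group action are 1 and the argument of F is Z, so the
product rule leaves three terms. The outer factors contribute P⁺F and FQ⁺, and the moving argument
contributes the derivative of F along ξ. -/
theorem rho2'_ev (X : gl2HC) (F : MS) : rho2' X (ev F) = ev (lieD (vP X) (vQ X) (vξ X) F) := by
  funext Z; ext i j
  have he (i j : Fin 2) : (NormedSpace.exp ((0 : ℂ) • X) : gl2HC) i j = (1 : gl2HC) i j := by
    rw [zero_smul, NormedSpace.exp_zero]
  have hi (i j : Fin 2) : HasMatDeriv (fun t => (NormedSpace.exp (-(t • X)) : gl2HC) i j)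
      (-(X i j)) := by
    simpa only [smul_neg, Matrix.neg_apply X] using hasMatDeriv_exp (-X) i j
  have hi0 (i j : Fin 2) : (NormedSpace.exp (-((0 : ℂ) • X)) : gl2HC) i j = (1 : gl2HC) i j := by
    rw [zero_smul, neg_zero, NormedSpace.exp_zero]
  have hZ := HasMatDeriv.const (Z : HC)
  have hu := (hasMatDeriv_exp X 0 0).sub (hZ.mul (hasMatDeriv_exp X 1 0))
  have hv := ((hi 1 0).mul hZ).add (hi 1 1)
  have hw := ((hi 0 0).mul hZ).add (hi 0 1)
  have hu0 : (NormedSpace.exp ((0 : ℂ) • X) : gl2HC) 0 0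
      - (Z : HC) * (NormedSpace.exp ((0 : ℂ) • X) : gl2HC) 1 0 = 1 := by simp
  have hv0 : (NormedSpace.exp (-((0 : ℂ) • X)) : gl2HC) 1 0 * (Z : HC)
      + (NormedSpace.exp (-((0 : ℂ) • X)) : gl2HC) 1 1 = 1 := by simp
  have hγ := hw.mul (hv.inv hv0)
  have hγ0 : ((NormedSpace.exp (-((0 : ℂ) • X)) : gl2HC) 0 0 * (Z : HC)
      + (NormedSpace.exp (-((0 : ℂ) • X)) : gl2HC) 0 1)
      * ((NormedSpace.exp (-((0 : ℂ) • X)) : gl2HC) 1 0 * (Z : HC)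
      + (NormedSpace.exp (-((0 : ℂ) • X)) : gl2HC) 1 1)⁻¹ = (Z : HC) := by simp
  have hF := hγ.comp_ev hγ0 F
  have h := ((hu.inv_N_smul hu0).mul hF).mul (hv.inv_N_smul hv0)
  refine (h i j).deriv.trans ?_
  have hN : N 1 = 1 := Matrix.det_one
  rw [hγ0, extend_unit, hu0, hv0]
  simp only [hi0, he, hN, inv_one, one_smul, one_mul, mul_one, mul_zero, zero_add, add_zero,
    Matrix.one_apply_eq, Matrix.one_apply_ne zero_ne_one, Matrix.one_apply_ne one_ne_zero]
  simp only [ev_apply, lieD, vP, vQ, vξ, Zm, Matrix.of_apply, Matrix.adjugate_fin_two,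
    Fin.sum_univ_two, Matrix.mul_apply, Matrix.add_apply, Matrix.sub_apply, Matrix.neg_apply,
    Matrix.smul_apply, Subalgebra.coe_add, Subalgebra.coe_sub, Subalgebra.coe_mul, Pi.add_apply,
    Pi.sub_apply, Pi.mul_apply, cm_apply, z_apply, Matrix.map_apply]
  fin_cases i <;> fin_cases j <;>
  simp [cm_apply, z_apply, -coe_D] <;> ring

/-! ### Homogeneous polynomial functions -/

/-- The polynomial functions which are homogeneous of degree `d`. -/
def Hom (d : ℤ) : Submodule ℂ Sh where
  carrier := {f | ∀ (c : ℂˣ) (Z : HCˣ), (f : HCˣ → ℂ) (c • Z) = (c : ℂ) ^ d * (f : HCˣ → ℂ) Z}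
  add_mem' {f g} hf hg c Z := by
    simp only [Subalgebra.coe_add, Pi.add_apply, hf c Z, hg c Z, mul_add]
  zero_mem' c Z := by simp
  smul_mem' a f hf c Z := by
    simp only [Subalgebra.coe_smul, Pi.smul_apply, hf c Z, smul_eq_mul, mul_left_comm]

theorem mul_mem_Hom {d e : ℤ} {f g : Sh} (hf : f ∈ Hom d) (hg : g ∈ Hom e) :
    f * g ∈ Hom (d + e) := fun c Z => by
  simp only [Subalgebra.coe_mul, Pi.mul_apply, hf c Z, hg c Z, zpow_add₀ c.ne_zero]
  ring

theorem z_mem_Hom (k l : Fin 2) : z k l ∈ Hom 1 := fun c Z => by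
  rw [z_apply, z_apply, zpow_one]; rfl

theorem n_mem_Hom : n ∈ Hom 2 := by
  have h1 := mul_mem_Hom (z_mem_Hom 0 0) (z_mem_Hom 1 1)
  have h2 := mul_mem_Hom (z_mem_Hom 0 1) (z_mem_Hom 1 0)
  rw [one_add_one_eq_two] at h1 h2
  exact Submodule.sub_mem _ h1 h2

theorem algebraMap_mem_Hom (c : ℂ) : algebraMap ℂ Sh c ∈ Hom 0 := fun a Z => by
  rw [zpow_zero, one_mul]; rfl

/-- Homogeneity survives the extension by zero because scaling preserves non-invertibility, so both
sides take the default value 0 there. -/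
theorem extend_smul {d : ℤ} {f : Sh} (hf : f ∈ Hom d) (c : ℂˣ) (W : HC) :
    Function.extend Units.val (f : HCˣ → ℂ) 0 ((c : ℂ) • W)
      = (c : ℂ) ^ d * Function.extend Units.val (f : HCˣ → ℂ) 0 W := by
  by_cases hW : IsUnit W
  · obtain ⟨u, rfl⟩ := hW
    rw [extend_unit, ← hf c u]
    exact extend_unit _ (c • u)
  · have h1 : ¬∃ u : HCˣ, (u : HC) = W := hW
    have h2 : ¬∃ u : HCˣ, (u : HC) = (c : ℂ) • W := by
      rintro ⟨u, hu⟩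
      refine h1 ⟨c⁻¹ • u, ?_⟩
      rw [Units.val_smul, hu]
      change (c⁻¹ : ℂˣ) • (c • W) = W
      rw [inv_smul_smul]
    rw [Function.extend_apply' _ _ _ h1, Function.extend_apply' _ _ _ h2]
    simp

/-- Differentiate f(cZ + tE) = c^d f(Z + c⁻¹tE) in t. -/
theorem D_mem_Hom {d : ℤ} {f : Sh} (hf : f ∈ Hom d) (i j : Fin 2) : D i j f ∈ Hom (d - 1) := by
  intro c Z
  have h : (fun t : ℂ => Function.extend Units.val (f : HCˣ → ℂ) 0
      (((c • Z : HCˣ) : HC) + t • Matrix.single i j 1)) = fun t => (c : ℂ) ^ d *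
      (fun t : ℂ => Function.extend Units.val (f : HCˣ → ℂ) 0
        ((Z : HC) + t • Matrix.single i j 1)) ((c : ℂ)⁻¹ * t) := by
    funext t
    simp only
    rw [← extend_smul hf c, smul_add, smul_smul, mul_inv_cancel_left₀ c.ne_zero]
    rfl
  have h2 := deriv_comp_mul_left ((c : ℂ)⁻¹) (fun t : ℂ => Function.extend Units.val
    (f : HCˣ → ℂ) 0 ((Z : HC) + t • Matrix.single i j 1)) 0
  rw [mul_zero, smul_eq_mul] at h2
  change deriv _ 0 = _ * deriv _ 0
  rw [h, deriv_const_mul_field, h2, zpow_sub_one₀ c.ne_zero, mul_assoc]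

/-- Euler's identity. -/
theorem euler {d : ℤ} {f : Sh} (hf : f ∈ Hom d) :
    z 0 0 * D 0 0 f + z 0 1 * D 0 1 f + z 1 0 * D 1 0 f + z 1 1 * D 1 1 f = d * f := by
  refine Subtype.ext (funext fun Z => ?_)
  -- The identity results from computing the derivative of f((1+t)Z) at t = 0 both by the chain rule
  -- and by homogeneity.
  have hγ : HasMatDeriv (fun t => (1 + t) • (Z : HC)) (Z : HC) := by
    have h := HasMatDeriv.smul ((hasDerivAt_id (0 : ℂ)).const_add 1) (HasMatDeriv.const (Z : HC))
    rwa [one_smul, smul_zero, add_zero] at h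
  have h1 := hγ.comp (Z := Z) (by simp) f
  have h2 : HasDerivAt (fun t : ℂ => (1 + t) ^ d * (f : HCˣ → ℂ) Z)
      ((d : ℂ) * (f : HCˣ → ℂ) Z) 0 := by
    have h := ((hasDerivAt_zpow d (1 + (0 : ℂ)) (Or.inl (by simp))).comp (0 : ℂ)
      ((hasDerivAt_id (0 : ℂ)).const_add 1)).mul_const ((f : HCˣ → ℂ) Z)
    simpa using h
  have h3 := h1.unique (h2.congr_of_eventuallyEq (by
    have hc : ContinuousAt (fun t : ℂ => 1 + t) 0 := by fun_prop
    filter_upwards [hc.eventually_ne (y := 0) (by simp)] with t ht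
    have h := extend_smul hf (Units.mk0 (1 + t) ht) (Z : HC)
    rwa [extend_unit, Units.val_mk0] at h))
  simp only [Fin.sum_univ_two] at h3
  have h4 : ((d * f : Sh) : HCˣ → ℂ) Z = d * (f : HCˣ → ℂ) Z := by
    rw [← zsmul_eq_mul, ← zsmul_eq_mul]; rfl
  rw [h4, ← h3]
  change (Z : HC) 0 0 * _ + (Z : HC) 0 1 * _ + (Z : HC) 1 0 * _ + (Z : HC) 1 1 * _ = _
  ring

theorem intCast_mul_eq_smul (d : ℤ) (f : Sh) : (d : Sh) * f = (d : ℂ) • f := by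
  rw [← zsmul_eq_mul, ← Int.cast_smul_eq_zsmul ℂ]

theorem eq_zero_of_intCast_mul {d : ℤ} (hd : d ≠ 0) {f : Sh} (h : (d : Sh) * f = 0) : f = 0 := by
  rwa [intCast_mul_eq_smul, smul_eq_zero_iff_right (by exact_mod_cast hd)] at h

/-- Homogeneous functions of different degrees are linearly independent. -/
theorem eq_zero_of_sum_Hom (v : ℤ →₀ Sh) (hv : ∀ d, v d ∈ Hom d)
    (h : (v.sum fun _ f => f) = 0) : v = 0 := by
  -- The powers c ↦ c^d are distinct characters of ℂˣ, as their values at 2 show, hence linearly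
  -- independent. Restricting the relation to the orbit ℂˣZ makes the values v_d(Z) its
  -- coefficients.
  let χ : ℤ → ℂˣ →* ℂ := fun d => (Units.coeHom ℂ).comp (zpowGroupHom d)
  have hχ : Function.Injective χ := fun d e hde => by
    have h2 := DFunLike.congr_fun hde (Units.mk0 (2 : ℂ) two_ne_zero)
    have h3 : (2 : ℂ) ^ d = (2 : ℂ) ^ e := by simpa [χ] using h2
    have h4 : ((2 : ℝ) ^ d) = (2 : ℝ) ^ e := by
      apply Complex.ofReal_injective
      push_cast
      exact h3
    exact zpow_right_injective₀ two_pos (by norm_num) h4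
  have hli := (linearIndependent_monoidHom ℂˣ ℂ).comp χ hχ
  refine Finsupp.ext fun d => Subtype.ext (funext fun Z => ?_)
  by_cases hd : d ∈ v.support
  · refine linearIndependent_iff'.1 hli v.support (fun d => (v d : HCˣ → ℂ) Z) ?_ d hd
    funext c
    have h1 : ((v.sum fun _ f => f : Sh) : HCˣ → ℂ) (c • Z) = 0 := by rw [h]; rfl
    rw [Finsupp.sum, AddSubmonoidClass.coe_finsetSum, Finset.sum_apply] at h1
    rw [Finset.sum_apply, Pi.zero_apply, ← h1]
    refine Finset.sum_congr rfl fun d _ => ?_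
    rw [hv d c Z, mul_comm]
    simp [χ]
  · rw [Finsupp.notMem_support_iff.1 hd]; rfl

/-! ### Polynomial numerators and the grading by degree. -/

/-- The span of the coordinate functions; its power `V ^ m` is the space of homogeneous
polynomials of degree `m`. -/
def V : Submodule ℂ Sh := Submodule.span ℂ (Set.range fun p : Fin 2 × Fin 2 => z p.1 p.2)

theorem z_mem_V (k l : Fin 2) : z k l ∈ V := Submodule.subset_span ⟨(k, l), rfl⟩

theorem n_mem_V : n ∈ V ^ 2 := by
  rw [pow_two]
  exact sub_mem (Submodule.mul_mem_mul (z_mem_V _ _) (z_mem_V _ _))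
    (Submodule.mul_mem_mul (z_mem_V _ _) (z_mem_V _ _))

theorem V_pow_le (m : ℕ) : V ^ m ≤ Hom m := by
  induction m with
  | zero =>
    rw [pow_zero]
    rintro f hf
    obtain ⟨c, rfl⟩ := Submodule.mem_one.1 hf
    exact algebraMap_mem_Hom c
  | succ m ih =>
    rw [pow_succ, Submodule.mul_le]
    intro f hf g hg
    have hV : V ≤ Hom 1 := Submodule.span_le.2 (by rintro _ ⟨p, rfl⟩; exact z_mem_Hom _ _)
    exact_mod_cast mul_mem_Hom (ih hf) (hV hg)

theorem D_mem_V_zero {g : Sh} (hg : g ∈ V ^ 0) (i j : Fin 2) : D i j g = 0 := by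
  rw [pow_zero] at hg
  obtain ⟨c, rfl⟩ := Submodule.mem_one.1 hg
  exact Derivation.map_algebraMap _ c

theorem D_mem_V_pow (m : ℕ) {f : Sh} (hf : f ∈ V ^ (m + 1)) (i j : Fin 2) : D i j f ∈ V ^ m := by
  have hV : ∀ g ∈ V, D i j g ∈ V ^ 0 := fun g hg => by
    induction hg using Submodule.span_induction with
    | mem x hx =>
      obtain ⟨p, rfl⟩ := hx
      rw [D_z]
      split_ifs
      · rw [pow_zero]; exact Submodule.one_le.1 le_rfl
      · exact zero_mem _
    | zero => rw [map_zero]; exact zero_mem _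
    | add x y _ _ hx hy => rw [map_add]; exact add_mem hx hy
    | smul c x _ hx => rw [Derivation.map_smul]; exact Submodule.smul_mem _ c hx
  induction m generalizing f with
  | zero => exact hV f (by simpa using hf)
  | succ m ih =>
    rw [pow_succ] at hf
    induction hf using Submodule.mul_induction_on' with
    | mem_mul_mem p hp v hv =>
      rw [D_mul]
      refine add_mem ?_ ?_
      · have := Submodule.mul_mem_mul hp (hV v hv)
        rwa [← pow_add, add_zero] at this
      · rw [mul_comm, pow_succ]
        exact Submodule.mul_mem_mul (ih hp) hv
    | add x _ y _ hx hy => rw [map_add]; exact add_mem hx hy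

theorem lap_mem_V_pow {m : ℕ} {f : Sh} (hf : f ∈ V ^ (m + 2)) : lap f ∈ V ^ m :=
  sub_mem (D_mem_V_pow m (D_mem_V_pow (m + 1) hf _ _) _ _)
    (D_mem_V_pow m (D_mem_V_pow (m + 1) hf _ _) _ _)

theorem lap_mem_V_one {f : Sh} (hf : f ∈ V ^ 1) : lap f = 0 := by
  rw [lap, D_mem_V_zero (D_mem_V_pow 0 hf _ _), D_mem_V_zero (D_mem_V_pow 0 hf _ _), sub_zero]

theorem n_pow_mul_mem (k : ℕ) {m : ℕ} {f : Sh} (hf : f ∈ V ^ m) :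
    n ^ k * f ∈ V ^ (2 * k + m) := by
  rw [pow_add, pow_mul]
  exact Submodule.mul_mem_mul (Submodule.pow_mem_pow _ n_mem_V k) hf

/-- The functions `N⁻ᵏ p` with a homogeneous polynomial `p` of degree `2 k + d`. -/
def Frac (d : ℤ) : Submodule ℂ Sh where
  carrier := {f | ∃ k m : ℕ, (m : ℤ) = 2 * k + d ∧ n ^ k * f ∈ V ^ m}
  add_mem' {f g} := by
    rintro ⟨k, m, hm, hf⟩ ⟨k', m', hm', hg⟩
    refine ⟨k + k', 2 * k' + m, by push_cast; omega, ?_⟩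
    rw [mul_add]
    refine add_mem ?_ ?_
    · have h := n_pow_mul_mem k' hf
      rwa [← mul_assoc, ← pow_add, add_comm k'] at h
    · have h : 2 * k' + m = 2 * k + m' := by omega
      have h' := n_pow_mul_mem k hg
      rwa [← mul_assoc, ← pow_add, ← h] at h'
  -- Any exponent k with 2k + d ≥ 0 would serve, and |d| always does.
  zero_mem' := ⟨d.natAbs, (2 * d.natAbs + d).toNat, by omega, by simp⟩
  smul_mem' c f := by
    rintro ⟨k, m, hm, hf⟩
    exact ⟨k, m, hm, by rw [mul_smul_comm]; exact Submodule.smul_mem _ c hf⟩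

theorem mul_mem_Frac {d e : ℤ} {f g : Sh} (hf : f ∈ Frac d) (hg : g ∈ Frac e) :
    f * g ∈ Frac (d + e) := by
  obtain ⟨k, m, hm, hf⟩ := hf
  obtain ⟨k', m', hm', hg⟩ := hg
  refine ⟨k + k', m + m', by push_cast; omega, ?_⟩
  rw [pow_add, pow_add, mul_mul_mul_comm]
  exact Submodule.mul_mem_mul hf hg

theorem n_pow_mul_ni_pow (k : ℕ) : ni ^ k * n ^ k = 1 := by
  rw [← mul_pow, mul_comm ni, n_mul_ni, one_pow]

theorem n_mul_cancel {f g : Sh} (h : n * f = n * g) : f = g := by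
  linear_combination ni * h + (g - f) * n_mul_ni

theorem ni_mem_Hom : ni ∈ Hom (-2) := fun c Z => by
  have h := n_mem_Hom c Z
  have h1 (Z : HCˣ) : (ni : HCˣ → ℂ) Z = ((n : HCˣ → ℂ) Z)⁻¹ := by rw [n_apply]; rfl
  rw [h1, h1, h, mul_inv, zpow_neg]

theorem Frac_le (d : ℤ) : Frac d ≤ Hom d := by
  rintro f ⟨k, m, hm, hf⟩
  have h1 : ni ^ k ∈ Hom (-2 * k) := by
    clear hm hf
    induction k with
    | zero => simpa using algebraMap_mem_Hom 1
    | succ k ih =>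
      have := mul_mem_Hom ih ni_mem_Hom
      rw [pow_succ]
      convert this using 2
      push_cast; ring
  have h2 := mul_mem_Hom h1 (V_pow_le m hf)
  rw [← mul_assoc, n_pow_mul_ni_pow, one_mul, hm] at h2
  convert h2 using 2
  ring

theorem iSup_Frac (f : Sh) : f ∈ ⨆ d, Frac d := by
  induction f using Sh_induction with
  | hz k l =>
    exact Submodule.mem_iSup_of_mem 1 ⟨0, 1, by simp, by simpa using z_mem_V k l⟩
  | hni =>
    refine Submodule.mem_iSup_of_mem (-2) ⟨1, 0, by simp, ?_⟩
    rw [pow_one, n_mul_ni, pow_zero]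
    exact Submodule.one_le.1 le_rfl
  | hc c =>
    refine Submodule.mem_iSup_of_mem 0 ⟨0, 0, by simp, ?_⟩
    rw [pow_zero, pow_zero, one_mul]
    exact Submodule.mem_one.2 ⟨c, rfl⟩
  | hadd f g hf hg => exact add_mem hf hg
  | hmul f g hf hg =>
    induction hf using Submodule.iSup_induction' with
    | mem d f hf =>
      induction hg using Submodule.iSup_induction' with
      | mem e g hg => exact Submodule.mem_iSup_of_mem (d + e) (mul_mem_Frac hf hg)
      | zero => rw [mul_zero]; exact zero_mem _
      | add x y _ _ hx hy => rw [mul_add]; exact add_mem hx hy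
    | zero => rw [zero_mul]; exact zero_mem _
    | add x y _ _ hx hy => rw [add_mul]; exact add_mem hx hy

theorem Hom_le_Frac {d : ℤ} {f : Sh} (hf : f ∈ Hom d) : f ∈ Frac d := by
  obtain ⟨v, hv, hvf⟩ := (Submodule.mem_iSup_iff_exists_finsupp _ _).1 (iSup_Frac f)
  -- The decomposition of f into fractions is compared with f itself placed in degree d.
  -- Independence of degrees identifies f with its own component.
  have h := eq_zero_of_sum_Hom (v - Finsupp.single d f) (fun e => by
    rw [Finsupp.sub_apply]
    refine sub_mem (Frac_le e (hv e)) ?_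
    by_cases h : d = e
    · subst h; rwa [Finsupp.single_eq_same]
    · rw [Finsupp.single_eq_of_ne' h]; exact zero_mem _) (by
    rw [Finsupp.sum_sub_index (fun _ _ _ => rfl), hvf, Finsupp.sum_single_index rfl, sub_self])
  have h2 := DFunLike.congr_fun h d
  rw [Finsupp.sub_apply, Finsupp.single_eq_same, Finsupp.zero_apply, sub_eq_zero] at h2
  exact h2 ▸ hv d

/-! ### Harmonic functions of low degree -/

/-- The cross terms in the product rule are the Euler operator applied to f, giving d f, and lap N =
2 supplies the rest. -/
theorem lap_n_mul {d : ℤ} {f : Sh} (hf : f ∈ Hom d) :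
    lap (n * f) = n * lap f + ((d + 2 : ℤ) : Sh) * f := by
  have h := euler hf
  simp [lap, n, D_z]
  linear_combination h

theorem n_pow_mul_mem_Hom {d : ℤ} {f : Sh} (hf : f ∈ Hom d) (k : ℕ) :
    n ^ k * f ∈ Hom (2 * k + d) := by
  induction k with
  | zero => simpa using hf
  | succ k ih =>
    rw [pow_succ', mul_assoc]
    convert mul_mem_Hom n_mem_Hom ih using 2
    push_cast; ring

theorem lap_n_pow_mul {d : ℤ} {f : Sh} (hf : f ∈ Hom d) (h0 : lap f = 0) (k : ℕ) :
    lap (n ^ (k + 1) * f) = (((k + 1) * (k + d + 2) : ℤ) : Sh) * (n ^ k * f) := by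
  induction k with
  | zero => rw [zero_add, pow_one, lap_n_mul hf, h0]; push_cast; ring
  | succ k ih =>
    rw [pow_succ', mul_assoc, lap_n_mul (n_pow_mul_mem_Hom hf _), ih]
    push_cast; ring

theorem mem_of_intCast_mul {d : ℤ} (hd : d ≠ 0) {f : Sh} {S : Submodule ℂ Sh}
    (h : (d : Sh) * f ∈ S) : f ∈ S := by
  rw [intCast_mul_eq_smul] at h
  exact (Submodule.smul_mem_iff _ (by exact_mod_cast hd)).1 h

/-- There are no harmonic functions of degree `-1`. -/
theorem eq_zero_of_lap_of_mem_Hom {f : Sh} (hf : f ∈ Hom (-1)) (h0 : lap f = 0) : f = 0 := by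
  obtain ⟨k, m, hm, hk⟩ := Hom_le_Frac hf
  induction k generalizing m with
  | zero => omega
  | succ k ih =>
    have h1 := lap_n_pow_mul hf h0 k
    -- The factor is (k+1)², so `n ^ k * f` is a nonzero multiple of the Laplacian of the numerator
    -- `n ^ (k + 1) * f`. Thus the denominator loses one factor N, and the numerator two degrees.
    have hne : ((k : ℤ) + 1) * (k + -1 + 2) ≠ 0 := mul_ne_zero (by omega) (by omega)
    -- With a single N in the denominator, the numerator is linear, so its Laplacian vanishes.
    obtain _ | k := k
    · obtain rfl : m = 1 := by push_cast at hm; omega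
      rw [lap_mem_V_one hk, pow_zero, one_mul] at h1
      exact eq_zero_of_intCast_mul hne h1.symm
    · obtain ⟨m, rfl⟩ : ∃ m', m = m' + 2 := ⟨m - 2, by push_cast at hm; omega⟩
      refine ih m (by push_cast at hm ⊢; omega) (mem_of_intCast_mul hne ?_)
      rw [← h1]
      exact lap_mem_V_pow hk

/-- The harmonic functions of degree `-2` are the multiples of `N⁻¹`. -/
theorem exists_eq_of_lap_of_mem_Hom {f : Sh} (hf : f ∈ Hom (-2)) (h0 : lap f = 0) :
    ∃ c : ℂ, n * f = algebraMap ℂ Sh c := by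
  obtain ⟨k, m, hm, hk⟩ := Hom_le_Frac hf
  induction k generalizing m with
  | zero => omega
  | succ k ih =>
    obtain _ | k := k
    · obtain rfl : m = 0 := by push_cast at hm; omega
      rw [pow_zero, zero_add, pow_one] at hk
      obtain ⟨c, hc⟩ := Submodule.mem_one.1 hk
      exact ⟨c, hc.symm⟩
    · have h1 := lap_n_pow_mul hf h0 (k + 1)
      -- In degree -2 the same descent has factor (k+2)(k+1). It would vanish one step further, so
      -- the descent stops at a single N in the denominator, with a constant numerator.
      have hne : (((k + 1 : ℕ) : ℤ) + 1) * ((k + 1 : ℕ) + -2 + 2) ≠ 0 :=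
        mul_ne_zero (by omega) (by omega)
      obtain ⟨m, rfl⟩ : ∃ m', m = m' + 2 := ⟨m - 2, by push_cast at hm; omega⟩
      refine ih m (by push_cast at hm ⊢; omega) (mem_of_intCast_mul hne ?_)
      rw [← h1]
      exact lap_mem_V_pow hk

/-- A function all of whose partial derivatives vanish is constant. -/
theorem exists_eq_of_D_eq_zero {f : Sh} (h : ∀ i j, D i j f = 0) :
    ∃ c : ℂ, f = algebraMap ℂ Sh c := by
  obtain ⟨v, hv, hvf⟩ := (Submodule.mem_iSup_iff_exists_finsupp _ _).1 (iSup_Frac f)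
  have hD : ∀ i j d, D i j (v d) = 0 := fun i j d => by
    -- A partial derivative lowers the degree by one, so the derivatives of the components,
    -- reindexed by e ↦ e - 1, form a homogeneous decomposition of D f = 0.
    let w : ℤ →₀ Sh := Finsupp.embDomain (Equiv.subRight (1 : ℤ)).toEmbedding
      (v.mapRange (D i j) (map_zero _))
    have hw : ∀ e, w (e - 1) = D i j (v e) := fun e => by
      have := Finsupp.embDomain_apply_self (Equiv.subRight (1 : ℤ)).toEmbedding
        (v.mapRange (D i j) (map_zero _)) e
      exact this
    have h1 : w = 0 := eq_zero_of_sum_Hom w (fun e => by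
      have := hw (e + 1)
      rw [add_sub_cancel_right] at this
      rw [this]
      have h2 := D_mem_Hom (Frac_le _ (hv (e + 1))) i j
      rwa [add_sub_cancel_right] at h2) (by
      rw [Finsupp.sum_embDomain, Finsupp.sum_mapRange_index (fun _ => rfl), ← h i j, ← hvf,
        Finsupp.sum, Finsupp.sum, map_sum])
    rw [← hw, h1]; rfl
  -- Euler's identity kills every component of nonzero degree.
  have hv0 : ∀ d ≠ 0, v d = 0 := fun d hd => by
    refine eq_zero_of_intCast_mul hd ?_
    rw [← euler (Frac_le _ (hv d))]
    simp only [hD, mul_zero, add_zero]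
  have hf : f ∈ Hom 0 := by
    rw [← hvf]
    refine Submodule.sum_mem _ fun d _ => ?_
    by_cases hd : d = 0
    · exact hd ▸ Frac_le _ (hv d)
    · simp only [hv0 d hd]; exact zero_mem _
  -- Dividing by N lands in degree -2, where the coefficient d + 2 of `lap_n_mul` vanishes. Hence
  -- f/N is harmonic, and the classification in degree -2 makes f constant.
  have hg : ni * f ∈ Hom (-2) := by simpa using mul_mem_Hom ni_mem_Hom hf
  have hng : n * (ni * f) = f := by rw [← mul_assoc, n_mul_ni, one_mul]
  have hl := lap_n_mul hg
  have hlf : lap f = 0 := by simp only [lap, h, map_zero, sub_zero]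
  rw [hng, hlf] at hl
  obtain ⟨c, hc⟩ := exists_eq_of_lap_of_mem_Hom hg (n_mul_cancel (g := 0) (by
    push_cast at hl
    linear_combination -hl))
  exact ⟨c, hng ▸ hc⟩

/-! ### The space `ℳ` -/

/-- The matrix `(∂q)⁺`; `F` is a solution of the
Maxwell equation iff `gradAdj (dv F) = 2 (□/4) F`. -/
def gradAdj (q : Sh) : MS := !![D 1 1 q, -D 1 0 q; -D 0 1 q, D 0 0 q]

theorem isMaxwell_iff {F : MS} : IsMaxwell F ↔ ∀ a b, gradAdj (dv F) a b = 2 * lap (F a b) := by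
  simp only [Fin.forall_fin_two, gradAdj, Matrix.of_apply, Matrix.cons_val', Matrix.cons_val_zero,
    Matrix.cons_val_one, Matrix.cons_val_fin_one]
  constructor
  · rintro ⟨h00, h01, h10, h11⟩
    exact ⟨⟨h11, by linear_combination -h10⟩, by linear_combination -h01, h00⟩
  · rintro ⟨⟨h00, h10⟩, h01, h11⟩
    exact ⟨h11, by linear_combination -h01, by linear_combination -h10, h00⟩

theorem lap_gradAdj {q : Sh} (hq : lap q = 0) (a b : Fin 2) : lap (gradAdj q a b) = 0 := by
  revert a b
  simp only [Fin.forall_fin_two, gradAdj, Matrix.of_apply, Matrix.cons_val', Matrix.cons_val_zero,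
    Matrix.cons_val_one, Matrix.cons_val_fin_one, lap_neg, ← D_lap, hq, map_zero, neg_zero,
    and_self]

theorem gradAdj_mem_Hom {d : ℤ} {q : Sh} (hq : q ∈ Hom d) (a b : Fin 2) :
    gradAdj q a b ∈ Hom (d - 1) := by
  revert a b
  simp only [Fin.forall_fin_two, gradAdj, Matrix.of_apply, Matrix.cons_val', Matrix.cons_val_zero,
    Matrix.cons_val_one, Matrix.cons_val_fin_one, neg_mem_iff, D_mem_Hom hq, and_self]

/-- The divergence of `N · gradAdj q`. -/
theorem dv_n_mul_gradAdj {d : ℤ} {q : Sh} (hq : q ∈ Hom d) :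
    dv (Matrix.of fun a b => n * gradAdj q a b) = (d : Sh) * q + n * (2 * lap q) := by
  have h := euler hq
  simp [dv, gradAdj, n, D_z, lap, D_comm_11_00, D_comm_10_01]
  linear_combination h

theorem dv_add (F G : MS) : dv (F + G) = dv F + dv G := by
  simp only [dv, Matrix.add_apply, map_add]; ring1

theorem dv_smul (c : ℂ) (F : MS) : dv (c • F) = c • dv F := by
  simp only [dv, Matrix.smul_apply, Derivation.map_smul, smul_add]

theorem gradAdj_add (q r : Sh) (a b : Fin 2) :
    gradAdj (q + r) a b = gradAdj q a b + gradAdj r a b := by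
  fin_cases a <;> fin_cases b <;> simp [gradAdj] <;> ring1

theorem gradAdj_smul (c : ℂ) (q : Sh) (a b : Fin 2) :
    gradAdj (c • q) a b = c • gradAdj q a b := by
  fin_cases a <;> fin_cases b <;> simp [gradAdj]

theorem dv_mem_Hom {d : ℤ} {F : MS} (hF : ∀ a b, F a b ∈ Hom d) : dv F ∈ Hom (d - 1) :=
  add_mem (add_mem (add_mem (D_mem_Hom (hF 0 0) _ _) (D_mem_Hom (hF 0 1) _ _))
    (D_mem_Hom (hF 1 0) _ _)) (D_mem_Hom (hF 1 1) _ _)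

theorem lap_mem_Hom {d : ℤ} {f : Sh} (hf : f ∈ Hom d) : lap f ∈ Hom (d - 2) := by
  have h : d - 2 = d - 1 - 1 := by ring
  rw [h]
  exact sub_mem (D_mem_Hom (D_mem_Hom hf _ _) _ _) (D_mem_Hom (D_mem_Hom hf _ _) _ _)

theorem lap_dv (F : MS) (h : ∀ a b, lap (F a b) = 0) : lap (dv F) = 0 := by
  simp only [dv, lap_add, ← D_lap, h, map_zero, add_zero]

theorem isHomogeneous_ev_iff {d : ℤ} {F : MS} :
    IsHomogeneous d (ev F) ↔ ∀ a b, F a b ∈ Hom d :=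
  ⟨fun h a b c Z => congrFun (congrFun (h c Z) a) b, fun h c Z => Matrix.ext fun a b => h a b c Z⟩

/-- The matrix of functions defining `formA d A` for harmonic `A`. -/
def formMS (d : ℤ) (A : MS) : MS :=
  A + ((d : ℂ) + 1)⁻¹ • Matrix.of fun a b => n * gradAdj (dv A) a b

/-- For harmonic A the identity for ∂A∂ loses its Laplacian term, so (∂A∂)⁺ is `gradAdj (dv A)`. -/
theorem formA_ev (d : ℤ) {A : MS} (h : ∀ a b, lap (A a b) = 0) :
    formA d (ev A) = ev (formMS d A) := by
  have hadj : ∀ a b, lap (A.adjugate a b) = 0 := by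
    simp [Fin.forall_fin_two, Matrix.adjugate_fin_two, lap_neg, h]
  funext Z
  rw [formA, delR_delL_ev]
  simp only [hadj, sub_zero]
  rw [congrFun (qconj_ev _) Z, formMS, map_add, map_smul, div_eq_inv_mul, mul_smul,
    ← n_apply]
  congr 2
  ext a b
  fin_cases a <;> fin_cases b <;> simp [Matrix.adjugate_fin_two, gradAdj, ev_apply]

theorem formMS_mem_Hom {d : ℤ} {A : MS} (hA : ∀ a b, A a b ∈ Hom d) (a b : Fin 2) :
    formMS d A a b ∈ Hom d := by
  refine add_mem (hA a b) (Submodule.smul_mem _ _ ?_)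
  have h := mul_mem_Hom n_mem_Hom (gradAdj_mem_Hom (dv_mem_Hom hA) a b)
  have hd : 2 + (d - 1 - 1) = d := by ring
  rwa [hd] at h

/-- With q = `dv A` harmonic of degree d - 1, the correction term adds (d-1)/(d+1) q to the
divergence, which becomes 2d/(d+1) q. Its Laplacian is d/(d+1) (∂q)⁺, exactly half the adjugate
gradient of the new divergence. -/
theorem formMS_mem_calM {d : ℤ} (hd : d ≠ -1) {A : MS} (hA : ∀ a b, A a b ∈ Hom d)
    (h : ∀ a b, lap (A a b) = 0) : ev (formMS d A) ∈ calM := by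
  have hd' : (d : ℂ) + 1 ≠ 0 := by
    intro h0
    exact hd (eq_neg_of_add_eq_zero_left (by exact_mod_cast h0))
  have hq := lap_dv A h
  have hqd := dv_mem_Hom hA
  have h1 : dv (formMS d A) = (2 * d * ((d : ℂ) + 1)⁻¹) • dv A := by
    rw [formMS, dv_add, dv_smul, dv_n_mul_gradAdj hqd, hq, intCast_mul_eq_smul, mul_zero, mul_zero,
      add_zero, smul_smul, ← one_smul ℂ (dv A), smul_smul, ← add_smul]
    simp only [one_smul, mul_one]
    congr 1
    push_cast
    field_simp
    ring
  rw [ev_mem_calM_iff, h1, lap_smul, hq, smul_zero, isMaxwell_iff, h1]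
  refine ⟨fun a b => ?_, rfl⟩
  rw [formMS, gradAdj_smul, Matrix.add_apply, lap_add, h, zero_add, Matrix.smul_apply, lap_smul,
    Matrix.of_apply, lap_n_mul (gradAdj_mem_Hom hqd a b), lap_gradAdj hq, mul_zero, zero_add,
    intCast_mul_eq_smul, mul_smul_comm]
  rw [two_mul_eq_smul, smul_smul, smul_smul]
  congr 1
  push_cast
  ring

/-! ### The special elements N(Z)Z and N(Z)⁻¹Z. -/

/-- The matrix of functions `N(Z) Z`. -/
def NZ : MS := Matrix.of fun a b => n * z a b

theorem NpowZ_one : NpowZ 1 = ev NZ := by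
  funext Z; ext a b
  simp [NpowZ, NZ, ev_apply, n_apply, z_apply]

theorem NpowZ_neg_one : NpowZ (-1) = ev (Matrix.of fun a b => ni * z a b) := by
  funext Z; ext a b
  simp [NpowZ, ev_apply, z_apply]
  left; rfl

/-- The divergence is 6N, from Euler's identity for N and the four diagonal derivatives, and lap N =
2. The nonzero value 12 is what separates N(Z)Z from ℳ. -/
theorem isMaxwell_NZ_and_lap_dv : IsMaxwell NZ ∧ lap (dv NZ) = 12 := by
  have h1 : dv NZ = 6 * n := by
    simp [NZ, dv, n, D_z]; ring1
  have h6 : ∀ i j, D i j 6 = 0 := fun i j => (D i j).map_natCast 6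
  rw [isMaxwell_iff, h1]
  constructor
  · intro a b
    fin_cases a <;> fin_cases b <;> simp [NZ, gradAdj, n, lap, D_z, h6] <;> ring1
  · simp [lap, n, D_z, h6]; ring1

theorem gradAdj_ni (a b : Fin 2) : gradAdj ni a b = -(ni * ni * z a b) := by
  fin_cases a <;> fin_cases b <;> simp [gradAdj, D_z, D_ni, n] <;> ring1

theorem NpowZ_neg_one_mem : NpowZ (-1) ∈ calM := by
  have h1 : dv (Matrix.of fun a b => ni * z a b) = 2 * ni := by
    simp [dv, D_z, D_ni, n]
    have := n_mul_ni
    rw [n] at this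
    linear_combination -2 * ni * this
  have h2 : lap ni = 0 := by
    simp [lap, D_z, D_ni, n]
    have := n_mul_ni
    rw [n] at this
    linear_combination 2 * ni ^ 2 * this
  rw [NpowZ_neg_one, ev_mem_calM_iff, isMaxwell_iff, h1, lap_two_mul, h2, mul_zero]
  refine ⟨fun a b => ?_, rfl⟩
  have h3 : lap (ni * z a b) = z a b * lap ni + -(ni * ni) * z a b := by
    fin_cases a <;> fin_cases b <;> simp [lap, D_z, D_ni, n] <;> ring1
  rw [Matrix.of_apply, h3, h2]
  fin_cases a <;> fin_cases b <;> simp [gradAdj, D_z, D_ni, n] <;> ring1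

/-! ### Homogeneous components -/

theorem exists_homogeneous_sum (F : MS) :
    ∃ v : ℤ →₀ MS, (∀ d a b, v d a b ∈ Hom d) ∧ (v.sum fun _ G => G) = F := by
  let H : ℤ → Submodule ℂ MS := fun d =>
    { carrier := {F | ∀ a b, F a b ∈ Hom d}
      add_mem' := fun hF hG a b => add_mem (hF a b) (hG a b)
      zero_mem' := fun _ _ => zero_mem _
      smul_mem' := fun c _ hF a b => Submodule.smul_mem _ c (hF a b) }
  have hs : ∀ (a b : Fin 2) (f : Sh), Matrix.single a b f ∈ ⨆ d, H d := fun a b f => by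
    have hf := iSup_Frac f
    induction hf using Submodule.iSup_induction' with
    | mem d f hf =>
      refine Submodule.mem_iSup_of_mem d fun i j => ?_
      rw [Matrix.single_apply]
      split_ifs
      · exact Frac_le d hf
      · exact zero_mem _
    | zero => rw [Matrix.single_zero]; exact zero_mem _
    | add x y _ _ hx hy => rw [Matrix.single_add]; exact add_mem hx hy
  have hF : F ∈ ⨆ d, H d := by
    rw [Matrix.matrix_eq_sum_single F]
    exact sum_mem fun a _ => sum_mem fun b _ => hs a b _
  obtain ⟨v, hv, h⟩ := (Submodule.mem_iSup_iff_exists_finsupp _ _).1 hF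
  exact ⟨v, hv, h⟩

/-- A homogeneous linear operator annihilates the homogeneous components of the elements of its
kernel. -/
theorem map_component_eq_zero (T : MS →ₗ[ℂ] Sh) (k : ℤ)
    (hT : ∀ (d : ℤ) (F : MS), (∀ a b, F a b ∈ Hom d) → T F ∈ Hom (d - k)) {v : ℤ →₀ MS}
    (hv : ∀ d a b, v d a b ∈ Hom d) (h : T (v.sum fun _ G => G) = 0) (d : ℤ) : T (v d) = 0 := by
  -- The images under T are reindexed by e ↦ e - k, so that each index is the actual degree and
  -- independence of degrees applies.
  let w : ℤ →₀ Sh := Finsupp.embDomain (Equiv.subRight k).toEmbedding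
    (v.mapRange T (map_zero _))
  have hw : ∀ e, w (e - k) = T (v e) := fun e =>
    Finsupp.embDomain_apply_self (Equiv.subRight k).toEmbedding (v.mapRange T (map_zero _)) e
  have h1 : w = 0 := eq_zero_of_sum_Hom w (fun e => by
    have := hw (e + k)
    rw [add_sub_cancel_right] at this
    rw [this]
    have h2 := hT _ _ (hv (e + k))
    rwa [add_sub_cancel_right] at h2) (by
    rw [Finsupp.sum_embDomain, Finsupp.sum_mapRange_index (fun _ => rfl), ← h,
      Finsupp.sum, Finsupp.sum, map_sum])
  rw [← hw, h1]; rfl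

theorem component_mem {v : ℤ →₀ MS} (hv : ∀ d a b, v d a b ∈ Hom d)
    (h : ev (v.sum fun _ G => G) ∈ calM) (d : ℤ) : IsMaxwell (v d) ∧ lap (dv (v d)) = 0 := by
  rw [ev_mem_calM_iff, isMaxwell_iff] at h
  rw [isMaxwell_iff]
  constructor
  · intro a b
    let T : MS →ₗ[ℂ] Sh :=
      { toFun := fun F => gradAdj (dv F) a b - 2 * lap (F a b)
        map_add' := fun F G => by
          rw [dv_add, gradAdj_add, Matrix.add_apply, lap_add]; ring
        map_smul' := fun c F => by
          rw [dv_smul, gradAdj_smul, Matrix.smul_apply, lap_smul, mul_smul_comm, RingHom.id_apply,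
            smul_sub] }
    refine sub_eq_zero.1 (map_component_eq_zero T 2 (fun d F hF => ?_) hv
      (sub_eq_zero.2 (h.1 a b)) d)
    have h1 := gradAdj_mem_Hom (dv_mem_Hom hF) a b
    have h2 : d - 1 - 1 = d - 2 := by ring
    rw [h2] at h1
    refine sub_mem h1 ?_
    rw [two_mul]
    exact add_mem (lap_mem_Hom (hF a b)) (lap_mem_Hom (hF a b))
  · let T : MS →ₗ[ℂ] Sh :=
      { toFun := fun F => lap (dv F)
        map_add' := fun F G => by rw [dv_add, lap_add]
        map_smul' := fun c F => by rw [dv_smul, lap_smul]; rfl }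
    refine map_component_eq_zero T 3 (fun d F hF => ?_) hv h.2 d
    have h1 := lap_mem_Hom (dv_mem_Hom hF)
    have h2 : d - 1 - 2 = d - 3 := by ring
    rwa [h2] at h1

/-! ### The span of the homogeneous generators -/

/-- The generators of `ℳ`. -/
def generators : Set (HCˣ → HC) := {NpowZ (-1)} ∪
  {F | ∃ (d : ℤ) (A : HCˣ → HC), d ≠ -1 ∧ A ∈ W' ∧ IsHomogeneous d A ∧ IsHarmonic A ∧
    F = formA d A}

theorem formMS_mem_generators {d : ℤ} (hd : d ≠ -1) {A : MS} (hA : ∀ a b, A a b ∈ Hom d)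
    (h : ∀ a b, lap (A a b) = 0) : ev (formMS d A) ∈ generators :=
  Or.inr ⟨d, ev A, hd, ev_mem A, isHomogeneous_ev_iff.2 hA, isHarmonic_ev_iff.2 h,
    (formA_ev d h).symm⟩

theorem lap_lap_eq_zero {F : MS} (hF : IsMaxwell F) (h : lap (dv F) = 0) (a b : Fin 2) :
    lap (lap (F a b)) = 0 := by
  rw [← two_mul_eq_zero, ← lap_two_mul, ← isMaxwell_iff.1 hF, lap_gradAdj h]

/-- Here 1/(d+1) is undefined, so this degree needs its own argument. The divergence is c N⁻¹ and F
= -N lap F, so the Maxwell equation expresses F through the gradient of N⁻¹. -/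
theorem exists_smul_of_degree_neg_one {F : MS} (hF : IsMaxwell F) (h : lap (dv F) = 0)
    (hd : ∀ a b, F a b ∈ Hom (-1)) : ∃ c : ℂ, ev F = c • NpowZ (-1) := by
  obtain ⟨c, hc⟩ := exists_eq_of_lap_of_mem_Hom (dv_mem_Hom hd) h
  have hdv : dv F = c • ni := by
    rw [Algebra.smul_def]
    linear_combination ni * hc - dv F * n_mul_ni
  -- As lap F is harmonic of degree -3, lap(N lap F) = -lap F. The sum is therefore harmonic of
  -- degree -1, hence zero.
  have h0 : ∀ a b, F a b + n * lap (F a b) = 0 := fun a b => by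
    have hl := lap_mem_Hom (hd a b)
    refine eq_zero_of_lap_of_mem_Hom (add_mem (hd a b) ?_) ?_
    · exact mul_mem_Hom n_mem_Hom hl
    · rw [lap_add, lap_n_mul hl, lap_lap_eq_zero hF h]
      push_cast
      ring
  have hF' := isMaxwell_iff.1 hF
  rw [hdv] at hF'
  refine ⟨c / 2, ?_⟩
  rw [NpowZ_neg_one, ← map_smul]
  congr 1
  refine Matrix.ext fun a b => ?_
  rw [Matrix.smul_apply, Matrix.of_apply]
  have h2 : 2 * F a b = algebraMap ℂ Sh c * (ni * z a b) := by
    have h4 := hF' a b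
    rw [gradAdj_smul, gradAdj_ni, Algebra.smul_def] at h4
    linear_combination 2 * h0 a b + n * h4 + algebraMap ℂ Sh c * ni * z a b * n_mul_ni
  rw [two_mul_eq_smul, ← Algebra.smul_def] at h2
  rw [div_eq_inv_mul, mul_smul, ← h2, smul_smul, inv_mul_cancel₀ two_ne_zero, one_smul]

theorem exists_eq_formMS {d : ℤ} (hd0 : d ≠ 0) (hd1 : d ≠ -1) {F : MS} (hF : IsMaxwell F)
    (h : lap (dv F) = 0) (hd : ∀ a b, F a b ∈ Hom d) :
    ∃ A : MS, (∀ a b, A a b ∈ Hom d) ∧ (∀ a b, lap (A a b) = 0) ∧ F = formMS d A := by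
  have hd0' : (d : ℂ) ≠ 0 := by exact_mod_cast hd0
  have hd1' : (d : ℂ) + 1 ≠ 0 := fun h0 =>
    hd1 (eq_neg_of_add_eq_zero_left (by exact_mod_cast h0))
  have hF' := isMaxwell_iff.1 hF
  have hqd := dv_mem_Hom hd
  have hn : ∀ a b, n * gradAdj (dv F) a b ∈ Hom d := fun a b => by
    have h1 := mul_mem_Hom n_mem_Hom (gradAdj_mem_Hom hqd a b)
    have h2 : 2 + (d - 1 - 1) = d := by ring
    rwa [h2] at h1
  -- The coefficient is chosen to make A harmonic, since lap(N(∂q)⁺) = d(∂q)⁺ = 2d lap F for q = `dv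
  -- F`.
  let A : MS := F + (-(2 * d : ℂ)⁻¹) • Matrix.of fun a b => n * gradAdj (dv F) a b
  have hdv : dv A = (((d : ℂ) + 1) / (2 * d)) • dv F := by
    rw [dv_add, dv_smul, dv_n_mul_gradAdj hqd, h, intCast_mul_eq_smul, mul_zero, mul_zero,
      add_zero, smul_smul]
    nth_rw 1 [← one_smul ℂ (dv F)]
    rw [← add_smul]
    congr 1
    push_cast
    field_simp
    ring
  refine ⟨A, fun a b => add_mem (hd a b) (Submodule.smul_mem _ _ (hn a b)), fun a b => ?_,
    Matrix.ext fun a b => ?_⟩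
  · change lap (F a b + (-(2 * d : ℂ)⁻¹) • (n * gradAdj (dv F) a b)) = 0
    rw [lap_add, lap_smul, lap_n_mul (gradAdj_mem_Hom hqd a b), lap_gradAdj h, hF', mul_zero, zero_add,
      intCast_mul_eq_smul, two_mul_eq_smul, smul_smul, smul_smul]
    nth_rw 1 [← one_smul ℂ (lap (F a b))]
    rw [← add_smul]
    have h0 : (1 : ℂ) + -(2 * (d : ℂ))⁻¹ * ((d - 1 - 1 + 2 : ℤ) : ℂ) * 2 = 0 := by
      push_cast
      field_simp
      ring
    rw [h0, zero_smul]
  · rw [formMS, hdv]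
    simp only [Matrix.add_apply, Matrix.smul_apply, Matrix.of_apply, gradAdj_smul, A,
      mul_smul_comm, smul_smul]
    rw [add_assoc, ← add_smul]
    have h0 : -(2 * (d : ℂ))⁻¹ + ((d : ℂ) + 1)⁻¹ * (((d : ℂ) + 1) / (2 * d)) = 0 := by
      field_simp
      ring
    rw [h0, zero_smul, add_zero]

/-- The coefficient 1/(2d) is unavailable here, but no correction is needed: the divergence is
harmonic of degree -1, hence zero, and the Maxwell equation then makes F itself harmonic. -/
theorem eq_formMS_zero {F : MS} (hF : IsMaxwell F) (h : lap (dv F) = 0)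
    (hd : ∀ a b, F a b ∈ Hom 0) : (∀ a b, lap (F a b) = 0) ∧ F = formMS 0 F := by
  have hq : dv F = 0 := eq_zero_of_lap_of_mem_Hom (dv_mem_Hom hd) h
  have hg : ∀ a b, gradAdj (0 : Sh) a b = 0 := by
    simp [Fin.forall_fin_two, gradAdj]
  refine ⟨fun a b => ?_, Matrix.ext fun a b => ?_⟩
  · rw [← two_mul_eq_zero, ← isMaxwell_iff.1 hF, hq, hg]
  · rw [formMS, hq, Matrix.add_apply, Matrix.smul_apply, Matrix.of_apply, hg, mul_zero, smul_zero,
      add_zero]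

theorem calM_eq_span : calM = Submodule.span ℂ generators := by
  apply le_antisymm
  · intro F hF
    obtain ⟨F, rfl⟩ := exists_ev hF.1
    obtain ⟨v, hv, rfl⟩ := exists_homogeneous_sum F
    rw [Finsupp.sum, map_sum]
    refine Submodule.sum_mem _ fun d _ => ?_
    obtain ⟨h1, h2⟩ := component_mem hv hF d
    by_cases hd1 : d = -1
    · subst hd1
      obtain ⟨c, hc⟩ := exists_smul_of_degree_neg_one h1 h2 (hv _)
      rw [hc]
      exact Submodule.smul_mem _ c (Submodule.subset_span (Or.inl rfl))
    by_cases hd0 : d = 0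
    · subst hd0
      obtain ⟨h3, h4⟩ := eq_formMS_zero h1 h2 (hv _)
      rw [h4]
      exact Submodule.subset_span (formMS_mem_generators hd1 (hv _) h3)
    · obtain ⟨A, hA, hl, hFA⟩ := exists_eq_formMS hd0 hd1 h1 h2 (hv d)
      rw [hFA]
      exact Submodule.subset_span (formMS_mem_generators hd1 hA hl)
  · rw [Submodule.span_le]
    rintro F (rfl | ⟨d, A, hd, hA, hAd, hAh, rfl⟩)
    · exact NpowZ_neg_one_mem
    · obtain ⟨A, rfl⟩ := exists_ev hA
      rw [isHarmonic_ev_iff] at hAh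
      rw [formA_ev d hAh]
      exact formMS_mem_calM hd (isHomogeneous_ev_iff.1 hAd) hAh

theorem isHomogeneous_formA {d : ℤ} {A : HCˣ → HC} (hA : A ∈ W') (hAd : IsHomogeneous d A)
    (hAh : IsHarmonic A) : IsHomogeneous d (formA d A) := by
  obtain ⟨A, rfl⟩ := exists_ev hA
  rw [isHarmonic_ev_iff] at hAh
  rw [formA_ev d hAh, isHomogeneous_ev_iff]
  exact formMS_mem_Hom (isHomogeneous_ev_iff.1 hAd)

/-! ### Biharmonic elements of `ker Mx` -/

theorem isBiharmonic_of_mem_calM {F : HCˣ → HC} (hF : F ∈ calM) : IsBiharmonic F := by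
  obtain ⟨F, rfl⟩ := exists_ev hF.1
  obtain ⟨h1, h2⟩ := ev_mem_calM_iff.1 hF
  exact h1.isBiharmonic_iff.2 fun i j => by rw [h2, map_zero]

theorem disjoint_calM_span : Disjoint calM (Submodule.span ℂ {NpowZ 1}) := by
  rw [Submodule.disjoint_def]
  intro F hF hF'
  obtain ⟨c, rfl⟩ := Submodule.mem_span_singleton.1 hF'
  rw [NpowZ_one, ← map_smul, ev_mem_calM_iff, dv_smul, lap_smul, isMaxwell_NZ_and_lap_dv.2] at hF
  have h12 : (12 : Sh) ≠ 0 := fun h => by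
    have h0 : (12 : ℂ) = 0 := congrFun (congrArg Subtype.val h) 1
    norm_num at h0
  rw [(smul_eq_zero.1 hF.2).resolve_right h12, zero_smul]

theorem sup_eq_biharmonic :
    ((calM ⊔ Submodule.span ℂ {NpowZ 1} : Submodule ℂ (HCˣ → HC)) : Set (HCˣ → HC)) =
      {F | F ∈ W' ∧ Mx F = 0 ∧ IsBiharmonic F} := by
  have h12 : (12 : Sh) = algebraMap ℂ Sh 12 := rfl
  obtain ⟨hN1, hN2⟩ := isMaxwell_NZ_and_lap_dv
  ext F
  constructor
  · intro hF
    obtain ⟨G, hG, H, hH, rfl⟩ := Submodule.mem_sup.1 hF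
    obtain ⟨c, rfl⟩ := Submodule.mem_span_singleton.1 hH
    obtain ⟨G, rfl⟩ := exists_ev hG.1
    have hk : ev (G + c • NZ) ∈ kerMx := by
      rw [map_add, map_smul]
      exact add_mem ⟨hG.1, hG.2.1⟩ (Submodule.smul_mem _ c (ev_mem_kerMx_iff.2 hN1))
    rw [NpowZ_one, ← map_smul, ← map_add]
    refine ⟨hk.1, hk.2, (ev_mem_kerMx_iff.1 hk).isBiharmonic_iff.2 fun i j => ?_⟩
    rw [dv_add, lap_add, (ev_mem_calM_iff.1 hG).2, dv_smul, lap_smul, hN2, zero_add,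
      Derivation.map_smul, h12, Derivation.map_algebraMap, smul_zero]
  · rintro ⟨hW, hM, hB⟩
    obtain ⟨F, rfl⟩ := exists_ev hW
    rw [Mx_ev_eq_zero_iff] at hM
    obtain ⟨c, hc⟩ := exists_eq_of_D_eq_zero (hM.isBiharmonic_iff.1 hB)
    -- The constant c = `lap (dv F)` is removed by a multiple of N(Z)Z, for which it is 12.
    refine Submodule.mem_sup.2 ⟨ev (F + (-(c / 12)) • NZ), ?_,
      (c / 12) • NpowZ 1, Submodule.smul_mem _ _ (Submodule.mem_span_singleton_self _), ?_⟩
    · have hk : ev (F + (-(c / 12)) • NZ) ∈ kerMx := by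
        rw [map_add, map_smul]
        exact add_mem (ev_mem_kerMx_iff.2 hM) (Submodule.smul_mem _ _ (ev_mem_kerMx_iff.2 hN1))
      refine ev_mem_calM_iff.2 ⟨ev_mem_kerMx_iff.1 hk, ?_⟩
      rw [dv_add, lap_add, dv_smul, lap_smul, hN2, hc, h12,
        Algebra.smul_def, ← map_mul, ← map_add]
      rw [neg_mul, div_mul_cancel₀ c (by norm_num), add_neg_cancel, map_zero]
    · rw [NpowZ_one, map_add, map_smul, add_assoc, ← add_smul, neg_add_cancel, zero_smul,
        add_zero]

/-! ### Invariance -/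

theorem isRho2'Invariant_calM : IsRho2'Invariant calM := by
  intro X F hF
  obtain ⟨F, rfl⟩ := exists_ev hF.1
  obtain ⟨h1, h2⟩ := ev_mem_calM_iff.1 hF
  have hc := isConformal_vξ X
  rw [rho2'_ev, ev_mem_calM_iff, hc.lap_dv_lieD h1, h2]
  simp only [map_zero, mul_zero, add_zero]
  exact ⟨hc.isMaxwell_lieD h1, trivial⟩

theorem le_calM {V : Submodule ℂ (HCˣ → HC)} (hk : V ≤ kerMx) (hV : IsRho2'Invariant V)
    (hB : ∀ F ∈ V, IsBiharmonic F) : V ≤ calM := by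
  intro F hF
  obtain ⟨F, rfl⟩ := exists_ev (hk hF).1
  have h1 := ev_mem_kerMx_iff.1 (hk hF)
  have hD := h1.isBiharmonic_iff.1 (hB _ hF)
  -- A special conformal generator with C = E₁₁ makes Tr P + Tr Q non-constant, with ∂₁₁-derivative
  -- 2. As `lap (dv F)` is constant, biharmonicity of the transform gives 4 `lap (dv F)` = 0.
  let X : gl2HC := Matrix.single 1 0 (Matrix.single 0 0 1)
  have hG := hV X _ hF
  rw [rho2'_ev] at hG
  have hc := isConformal_vξ X
  have h2 := (hc.isMaxwell_lieD h1).isBiharmonic_iff.1 (hB _ hG) 0 0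
  have hC : cm (X 1 0) 0 0 = 1 := by
    simp [X, cm]
  rw [hc.lap_dv_lieD h1] at h2
  simp [hD, hc.dP, hc.dQ, hC] at h2
  refine ev_mem_calM_iff.2 ⟨h1, ?_⟩
  refine four_mul_eq_zero.1 ?_
  linear_combination h2

theorem isGreatest_calM : IsGreatest {V : Submodule ℂ (HCˣ → HC) |
    V ≤ kerMx ∧ IsRho2'Invariant V ∧ ∀ F ∈ V, IsBiharmonic F} calM :=
  ⟨⟨fun _ hF => ⟨hF.1, hF.2.1⟩, isRho2'Invariant_calM, fun _ => isBiharmonic_of_mem_calM⟩,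
    fun _ hV => le_calM hV.1 hV.2.1 hV.2.2⟩

end QuatAnalysis

end

theorem mainTheorem8 :
    -- `ℳ ⊕ ℂ·N(Z)Z` is the space of biharmonic elements of `ker Mx`
    (Disjoint calM (Submodule.span ℂ {NpowZ 1}) ∧
      ((calM ⊔ Submodule.span ℂ {NpowZ 1} : Submodule ℂ (HCˣ → HC)) : Set (HCˣ → HC)) =
        {F | F ∈ W' ∧ Mx F = 0 ∧ IsBiharmonic F}) ∧
    -- `ℳ` is spanned by `N(Z)⁻¹Z` and the elements `A_d + N(Z)/(d+1)·(∂A_d∂)⁺`,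
    -- which are homogeneous of degree `d`
    (calM = Submodule.span ℂ ({NpowZ (-1)} ∪
        {F | ∃ (d : ℤ) (A : HCˣ → HC), d ≠ -1 ∧ A ∈ W' ∧ IsHomogeneous d A ∧ IsHarmonic A ∧
          F = formA d A}) ∧
      ∀ (d : ℤ) (A : HCˣ → HC), d ≠ -1 → A ∈ W' → IsHomogeneous d A → IsHarmonic A →
        IsHomogeneous d (formA d A)) ∧
    -- `ℳ` is the unique maximal invariant subspace of `ker Mx` consisting of biharmonic functions
    (IsGreatest {V : Submodule ℂ (HCˣ → HC) |
        V ≤ kerMx ∧ IsRho2'Invariant V ∧ ∀ F ∈ V, IsBiharmonic F} calM ∧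
      ∀ V : Submodule ℂ (HCˣ → HC),
        Maximal (fun U => U ≤ kerMx ∧ IsRho2'Invariant U ∧ ∀ F ∈ U, IsBiharmonic F) V ↔ V = calM) :=
  ⟨⟨disjoint_calM_span, sup_eq_biharmonic⟩,
    ⟨calM_eq_span, fun _ _ _ => isHomogeneous_formA⟩,
    isGreatest_calM, fun _ => ⟨fun h => le_antisymm (isGreatest_calM.2 h.prop)
      (h.le_of_ge isGreatest_calM.1 (isGreatest_calM.2 h.prop)),
      fun h => h ▸ ⟨isGreatest_calM.1, fun _ hU _ => isGreatest_calM.2 hU⟩⟩⟩
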